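/- Let $W:\mathbb{R}\setminus\{0\}\to\mathbb{R}$ be $C^\infty$ and even, and suppose that there are $\alpha>3$ and $R>0$ such that for every $i\in\{0,1,2,\dots\}$ there is a constant $C_i>0$ with $|W^{(i)}(x)|\le C_i|x|^{-\alpha-i}$ for all $|x|\ge R$. Let $u:[-1,1]\to\mathbb{R}$ be continuous and increasing, and such that $u|_{[-1,0]}$ and $u|_{[0,1]}$ are $C^\infty$ diffeomorphisms onto their images. Write $u'(0^\pm)$, $u''(0^\pm)$ for the one-sided derivatives at $0$, and $u'(\pm1)$, $u''(\pm1)$ for the one-sided derivatives at $\pm1$. For $\varepsilon>0$ put $k_1=\lceil -1/\varepsilon\rceil$, $k_2=\lfloor 1/\varepsilon\rfloor$, $N=k_2-k_1+1$ (the number of points of $\varepsilon\mathbb{Z}\cap[-1,1]$), let $u_\varepsilon$ be the restriction of $u$ to $\varepsilon\mathbb{Z}\cap[-1,1]$, and define the atomistic energy $$E_\varepsilon(u_\varepsilon)=\frac1{2N}\sum_{\substack{i,j\in\mathbb{Z}\cap[-1/\varepsilon,1/\varepsilon]\\ i\ne j}}W\!\left(\frac{u(\varepsilon j)-u(\varepsilon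 i)}{\varepsilon}\right).$$ Let $\varepsilon\to0^+$ along a sequence for which there are $a_1,a_2,b_1,b_2,c_1,c_2\in\mathbb{R}$ with $$\varepsilon k_1+1=a_1\varepsilon+a_2\varepsilon^2+o(\varepsilon^2),\qquad 1-\varepsilon k_2=b_1\varepsilon+b_2\varepsilon^2+o(\varepsilon^2),\qquad \frac1{N\varepsilon}=\frac12+c_1\varepsilon+c_2\varepsilon^2+o(\varepsilon^2).$$ Then all the series and integrals below converge absolutely, and along this sequence $$E_\varepsilon(u_\varepsilon)=E^0+\varepsilon E^1+\varepsilon^2E^2+o(\varepsilon^2),$$ where $$E^0=\frac12\int_{-1}^1\sum_{j=1}^\infty W(u'(x)j)\,dx,$$ $$\begin{aligned}E^1={}&\Big(a_1-\tfrac12\Big)E^0-\frac14\sum_{j=1}^\infty(j+2a_1-1)\big[W(u'(-1)j)+W(u'(1)j)\big]\\&-\frac14\sum_{j=2}^\infty(j-1)\big[W(u'(0^-)j)+W(u'(0^+)j)\big]+\frac12\sum_{i,j=1}^\infty W\big(u'(0^+)j+u'(0^-)i\big),\end{aligned}$$ $$\begin{aligned}E^2={}&-\frac1{48}\int_{-1}^1\sum_{j=1}^\infty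 W''(u'(x)j)\,u''(x)^2j^4\,dx+\Big(\tfrac14-a_1+a_2+a_1^2\Big)E^0\\ &+\frac12\sum_{j=1}^\infty\Big[-\tfrac14+a_1-a_2-a_1^2+\big(\tfrac14-\tfrac{a_1}2\big)j\Big]\big[W(u'(-1)j)+W(u'(1)j)\big]\\ &+\frac14\sum_{j=1}^\infty\Big[\big(\tfrac16-a_1+a_1^2\big)j+\big(a_1-\tfrac12\big)j^2+\tfrac13j^3\Big]\big[W'(u'(1)j)u''(1)-W'(u'(-1)j)u''(-1)\big]\\ &+\Big(\tfrac18-\tfrac{a_1}4\Big)\sum_{j=2}^\infty(j-1)\big[W(u'(0^-)j)+W(u'(0^+)j)\big]\\ &+\frac14\sum_{j=2}^\infty\Big(\tfrac16j-\tfrac12j^2+\tfrac13j^3\Big)\big[W'(u'(0^-)j)u''(0^-)-W'(u'(0^+)j)u''(0^+)\big]\\ &+\Big(\tfrac{a_1}2-\tfrac14\Big)\sum_{i,j=1}^\infty W\big(u'(0^+)j+u'(0^-)i\big)\\ &+\frac14\sum_{i,j=1}^\infty\big[u''(0^+)j^2-u''(0^-)i^2\big]W'\big(u'(0^+)j+u'(0^-)i\big).\end{aligned}$$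 -/

import Mathlib

open Set Filter Topology Asymptotics MeasureTheory
open scoped ContDiff

noncomputable section

namespace AtomChain

/-- `k₁ ∈ ℤ` is the integer with `a / ε - c ≤ k₁ < a / ε - c + 1`. -/
def k₁ (a c ε : ℝ) : ℤ := ⌈a / ε - c⌉

/-- `k₂ ∈ ℤ` is the integer with `b / ε - c - 1 < k₂ ≤ b / ε - c`. -/
def k₂ (b c ε : ℝ) : ℤ := ⌊b / ε - c⌋

/-- `N = k₂ - k₁ + 1`. -/
def siteNumber (a b c ε : ℝ) : ℤ := k₂ b c ε - k₁ a c ε + 1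

/-- The (labels `k` of the) atoms `ε (c + k)`, `k ∈ ℤ`, of the scaled lattice `ε (c + ℤ)` that lie
in `[a, b]`; see `mem_sites`. -/
def sites (a b c ε : ℝ) : Finset ℤ := Finset.Icc (k₁ a c ε) (k₂ b c ε)

theorem mem_sites {a b c ε : ℝ} (hε : 0 < ε) (k : ℤ) :
    k ∈ sites a b c ε ↔ ε * (c + k) ∈ Icc a b := by
  simp only [sites, k₁, k₂, Finset.mem_Icc, Int.ceil_le, Int.le_floor, mem_Icc,
    sub_le_iff_le_add, le_sub_iff_add_le, div_le_iff₀ hε, le_div_iff₀ hε]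
  constructor <;> rintro ⟨h₁, h₂⟩ <;> constructor <;> linarith

/-- The atomistic energy per atom of the deformation `u` restricted to `ε (c + ℤ) ∩ [a, b]`,
`(1 / (2 N)) ∑_{i ≠ j} W ((u (ε j) - u (ε i)) / ε)`, the sum being over ordered pairs of distinct
points of `(c + ℤ) ∩ [a, b] / ε`. -/
def energy (W u : ℝ → ℝ) (a b c ε : ℝ) : ℝ :=
  1 / (2 * ((sites a b c ε).card : ℝ)) *
    ∑ p ∈ (sites a b c ε).offDiag, W ((u (ε * (c + p.2)) - u (ε * (c + p.1))) / ε)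

/-- Along the sequence `ε`, the offsets between the lattice and the ends of `[a, b]`, and the
inverse number of atoms, have second-order expansions with the given coefficients. -/
structure HasOffsetExpansion (a b c : ℝ) (ε : ℕ → ℝ) (a₁ a₂ b₁ b₂ c₁ c₂ : ℝ) : Prop where
  left : (fun n => (ε n * (c + k₁ a c (ε n)) - a) - (a₁ * ε n + a₂ * ε n ^ 2))
    =o[atTop] fun n => ε n ^ 2
  right : (fun n => (b - ε n * (c + k₂ b c (ε n))) - (b₁ * ε n + b₂ * ε n ^ 2))
    =o[atTop] fun n => ε n ^ 2
  number : (fun n => 1 / (siteNumber a b c (ε n) : ℝ) * (1 / ε n)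
      - (1 / (b - a) + c₁ * ε n + c₂ * ε n ^ 2))
    =o[atTop] fun n => ε n ^ 2

/-- `f` restricted to `s` is a smooth diffeomorphism onto its image `f '' s`. -/
def IsSmoothDiffeoOn (f : ℝ → ℝ) (s : Set ℝ) : Prop :=
  ContDiffOn ℝ ∞ f s ∧ ∃ g : ℝ → ℝ, ContDiffOn ℝ ∞ g (f '' s) ∧ LeftInvOn g f s

/-- `∑_{j = m}^∞ f j`. -/
def seriesFrom (m : ℕ) (f : ℝ → ℝ) : ℝ := ∑' j : ℕ, f ((j + m : ℕ) : ℝ)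

/-- The series `∑_{j = m}^∞ f j` converges absolutely. -/
def SummableFrom (m : ℕ) (f : ℝ → ℝ) : Prop := Summable fun j : ℕ => f ((j + m : ℕ) : ℝ)

/-- `∑_{i, j = 1}^∞ f i j`. -/
def doubleSeries (f : ℝ → ℝ → ℝ) : ℝ :=
  ∑' p : ℕ × ℕ, f ((p.1 + 1 : ℕ) : ℝ) ((p.2 + 1 : ℕ) : ℝ)

/-- The double series `∑_{i, j = 1}^∞ f i j` converges absolutely. -/
def DoubleSummable (f : ℝ → ℝ → ℝ) : Prop :=
  Summable fun p : ℕ × ℕ => f ((p.1 + 1 : ℕ) : ℝ) ((p.2 + 1 : ℕ) : ℝ)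

/-- First derivative of `u` restricted to `[-1, 0]`; at `0` it is `u'(0⁻)`. -/
def dL (u : ℝ → ℝ) (x : ℝ) : ℝ := derivWithin u (Icc (-1) 0) x

/-- First derivative of `u` restricted to `[0, 1]`; at `0` it is `u'(0⁺)`. -/
def dR (u : ℝ → ℝ) (x : ℝ) : ℝ := derivWithin u (Icc 0 1) x

/-- Second derivative of `u` restricted to `[-1, 0]`; at `0` it is `u''(0⁻)`. -/
def ddL (u : ℝ → ℝ) (x : ℝ) : ℝ := iteratedDerivWithin 2 u (Icc (-1) 0) x

/-- Second derivative of `u` restricted to `[0, 1]`; at `0` it is `u''(0⁺)`. -/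
def ddR (u : ℝ → ℝ) (x : ℝ) : ℝ := iteratedDerivWithin 2 u (Icc 0 1) x

/-- `∑_{j = 1}^∞ W (u'(x) j)`. -/
def bulkDensity (W u : ℝ → ℝ) (x : ℝ) : ℝ := seriesFrom 1 fun j => W (deriv u x * j)

/-- `∑_{j = 1}^∞ W''(u'(x) j) u''(x)² j⁴`. -/
def gradientDensity (W u : ℝ → ℝ) (x : ℝ) : ℝ :=
  seriesFrom 1 fun j => iteratedDeriv 2 W (deriv u x * j) * iteratedDeriv 2 u x ^ 2 * j ^ 4

def E0 (W u : ℝ → ℝ) : ℝ := 1 / 2 * ∫ x in (-1 : ℝ)..1, bulkDensity W u x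

def E1 (W u : ℝ → ℝ) (a₁ : ℝ) : ℝ :=
  (a₁ - 1 / 2) * E0 W u
  - 1 / 4 * seriesFrom 1 (fun j => (j + 2 * a₁ - 1) * (W (dL u (-1) * j) + W (dR u 1 * j)))
  - 1 / 4 * seriesFrom 2 (fun j => (j - 1) * (W (dL u 0 * j) + W (dR u 0 * j)))
  + 1 / 2 * doubleSeries (fun i j => W (dR u 0 * j + dL u 0 * i))

def E2 (W u : ℝ → ℝ) (a₁ a₂ : ℝ) : ℝ :=
  -(1 / 48) * (∫ x in (-1 : ℝ)..1, gradientDensity W u x)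
  + (1 / 4 - a₁ + a₂ + a₁ ^ 2) * E0 W u
  + 1 / 2 * seriesFrom 1 (fun j =>
      (-(1 / 4) + a₁ - a₂ - a₁ ^ 2 + (1 / 4 - a₁ / 2) * j)
        * (W (dL u (-1) * j) + W (dR u 1 * j)))
  + 1 / 4 * seriesFrom 1 (fun j =>
      ((1 / 6 - a₁ + a₁ ^ 2) * j + (a₁ - 1 / 2) * j ^ 2 + 1 / 3 * j ^ 3)
        * (deriv W (dR u 1 * j) * ddR u 1 - deriv W (dL u (-1) * j) * ddL u (-1)))
  + (1 / 8 - a₁ / 4) * seriesFrom 2 (fun j => (j - 1) * (W (dL u 0 * j) + W (dR u 0 * j)))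
  + 1 / 4 * seriesFrom 2 (fun j =>
      (1 / 6 * j - 1 / 2 * j ^ 2 + 1 / 3 * j ^ 3)
        * (deriv W (dL u 0 * j) * ddL u 0 - deriv W (dR u 0 * j) * ddR u 0))
  + (a₁ / 2 - 1 / 4) * doubleSeries (fun i j => W (dR u 0 * j + dL u 0 * i))
  + 1 / 4 * doubleSeries (fun i j =>
      (ddR u 0 * j ^ 2 - ddL u 0 * i ^ 2) * deriv W (dR u 0 * j + dL u 0 * i))

/-- All the series and integrals in the coefficients `E0`, `E1`, `E2` converge (absolutely), so that
none of them takes a default value. -/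
structure CoefficientsConverge (W u : ℝ → ℝ) (a₁ a₂ : ℝ) : Prop where
  bulk_series : ∀ x ∈ Ioo (-1 : ℝ) 0 ∪ Ioo (0 : ℝ) 1, SummableFrom 1 fun j => W (deriv u x * j)
  bulk_integral : IntervalIntegrable (bulkDensity W u) volume (-1) 1
  gradient_series : ∀ x ∈ Ioo (-1 : ℝ) 0 ∪ Ioo (0 : ℝ) 1, SummableFrom 1 fun j =>
    iteratedDeriv 2 W (deriv u x * j) * iteratedDeriv 2 u x ^ 2 * j ^ 4
  gradient_integral : IntervalIntegrable (gradientDensity W u) volume (-1) 1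
  boundary₁ : SummableFrom 1 fun j => (j + 2 * a₁ - 1) * (W (dL u (-1) * j) + W (dR u 1 * j))
  interface₁ : SummableFrom 2 fun j => (j - 1) * (W (dL u 0 * j) + W (dR u 0 * j))
  double₁ : DoubleSummable fun i j => W (dR u 0 * j + dL u 0 * i)
  boundary₂ : SummableFrom 1 fun j =>
    (-(1 / 4) + a₁ - a₂ - a₁ ^ 2 + (1 / 4 - a₁ / 2) * j) * (W (dL u (-1) * j) + W (dR u 1 * j))
  boundary₂' : SummableFrom 1 fun j =>
    ((1 / 6 - a₁ + a₁ ^ 2) * j + (a₁ - 1 / 2) * j ^ 2 + 1 / 3 * j ^ 3)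
      * (deriv W (dR u 1 * j) * ddR u 1 - deriv W (dL u (-1) * j) * ddL u (-1))
  interface₂ : SummableFrom 2 fun j =>
    (1 / 6 * j - 1 / 2 * j ^ 2 + 1 / 3 * j ^ 3)
      * (deriv W (dL u 0 * j) * ddL u 0 - deriv W (dR u 0 * j) * ddR u 0)
  double₂ : DoubleSummable fun i j =>
    (ddR u 0 * j ^ 2 - ddL u 0 * i ^ 2) * deriv W (dR u 0 * j + dL u 0 * i)

end AtomChain

end

/-! Write `h = ε` and `n = ⌊1/h⌋`. The lattice is symmetric, `k₁ = -n` and `k₂ = n`, so `N = 2n + 1`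
and the gap at either end is `σ h` with `σ = a₁ + a₂ h + o(h)`. As `W` is even and `u` strictly
increasing, the energy is `1/N` times a sum `S` over unordered pairs. Cut at the kink, which is a
lattice point, `S` consists of the bonds in `[0, 1]`, the bonds in `[-1, 0]`, and the bonds
straddling `0`. The reflection `x ↦ -u(-x)` makes the left half another increasing chain on `[0,
1]`.

In one chain with deformation `v`, group bonds by neighbour distance `d`. The midpoints have spacing
`h`, so cells of length `h` around them tile an interval that misses `[0, 1]` by `h (d-1)/2` at the
left and `h (σ + (d-1)/2)` at the right. With `f(x) = W(d v'(x))`, the energy of a bond with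
midpoint `x` is the mean of `f` over its cell, plus `h²` times `correction`: the cubic term of the
strain gives `d³/24 W'(d v') v'''`, and replacing a midpoint value by a mean costs `-f''/24`.
Summing over cells gives integrals over the tiled interval; Taylor expansion of the antiderivative
of `f` at `0` and `1` gives the end terms. Integrating `correction` by parts yields the gradient
energy and more end terms.

For the straddling bonds, the strain tends to `v'(0) j + u'(0) i`, and its first-order change in `h`
gives the last double series.

The series are handled by dominated convergence: for fixed `d`, or fixed `(i, j)`, the rescaled
remainder converges (`tendsto_bondRemainder`, `tendsto_cross_term`). Uniformly in `h` it is at most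
a constant times `d^(2-α)`, or `(i+j)^(1-α)` (`abs_bondRemainder_le`, `abs_cross_sub_le`); both are
summable because `α > 3`. Finally `S` is divided by `N`, where `N h = 2 (1 - h (σ - 1/2))`. -/

noncomputable section

namespace AtomChain

/-- `f'` is the derivative of `f` within `s`, at every point of `s`. -/
def DerivOn (f f' : ℝ → ℝ) (s : Set ℝ) : Prop := ∀ x ∈ s, HasDerivWithinAt f (f' x) s x

/-! ### Taylor estimates with one-sided derivatives at the ends. -/

section Taylor

variable {F F₁ F₂ F₃ F₄ : ℝ → ℝ} {s t : Set ℝ} {x y M : ℝ}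

theorem DerivOn.mono (h : DerivOn F F₁ s) (hst : t ⊆ s) : DerivOn F F₁ t :=
  fun x hx => (h x (hst hx)).mono hst

theorem DerivOn.continuousOn (h : DerivOn F F₁ s) : ContinuousOn F s :=
  fun x hx => (h x hx).continuousWithinAt

theorem DerivOn.abs_sub_le (h : DerivOn F F₁ s) (hs : Convex ℝ s) (hM : ∀ x ∈ s, |F₁ x| ≤ M)
    (hx : x ∈ s) (hy : y ∈ s) : |F y - F x| ≤ M * |y - x| :=
  hs.norm_image_sub_le_of_norm_hasDerivWithin_le h hM hx hy

theorem uIcc_subset_of_convex (hs : Convex ℝ s) (hx : x ∈ s) (hy : y ∈ s) : uIcc x y ⊆ s := by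
  rw [← segment_eq_uIcc]; exact hs.segment_subset hx hy

theorem abs_sub_le_of_mem_uIcc {z : ℝ} (hz : z ∈ uIcc x y) : |z - x| ≤ |y - x| :=
  abs_sub_left_of_mem_uIcc hz

/-- The remainder, as a function of the endpoint, has as derivative the remainder of one order less
for `F₁`, so the mean value inequality raises the order by one. The factorials are given up, since
only the powers matter; the next two lemmas iterate this. -/
theorem DerivOn.taylor_one (h : DerivOn F F₁ s) (h₁ : DerivOn F₁ F₂ s) (hs : Convex ℝ s)
    (hM : ∀ x ∈ s, |F₂ x| ≤ M) (hx : x ∈ s) (hy : y ∈ s) :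
    |F y - F x - (y - x) * F₁ x| ≤ M * |y - x| ^ 2 := by
  have hsub := uIcc_subset_of_convex hs hx hy
  have hM0 : 0 ≤ M := (abs_nonneg _).trans (hM x hx)
  have key : DerivOn (fun z => F z - (z - x) * F₁ x) (fun z => F₁ z - F₁ x) (uIcc x y) := by
    intro z hz
    have := (h.mono hsub z hz).sub
      ((((hasDerivAt_id z).sub_const x).mul_const (F₁ x)).hasDerivWithinAt (s := uIcc x y))
    exact this.congr_deriv (by simp)
  have := key.abs_sub_le (convex_uIcc x y) (M := M * |y - x|) (fun z hz =>
    (h₁.abs_sub_le hs hM hx (hsub hz)).trans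
      (mul_le_mul_of_nonneg_left (abs_sub_le_of_mem_uIcc hz) hM0))
    left_mem_uIcc right_mem_uIcc
  calc _ = |F y - (y - x) * F₁ x - (F x - (x - x) * F₁ x)| := by congr 1; ring
    _ ≤ _ := this
    _ = _ := by ring

theorem DerivOn.taylor_two (h : DerivOn F F₁ s) (h₁ : DerivOn F₁ F₂ s) (h₂ : DerivOn F₂ F₃ s)
    (hs : Convex ℝ s) (hM : ∀ x ∈ s, |F₃ x| ≤ M) (hx : x ∈ s) (hy : y ∈ s) :
    |F y - F x - (y - x) * F₁ x - (y - x) ^ 2 / 2 * F₂ x| ≤ M * |y - x| ^ 3 := by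
  have hsub := uIcc_subset_of_convex hs hx hy
  have hM0 : 0 ≤ M := (abs_nonneg _).trans (hM x hx)
  have key : DerivOn (fun z => F z - (z - x) * F₁ x - (z - x) ^ 2 / 2 * F₂ x)
      (fun z => F₁ z - F₁ x - (z - x) * F₂ x) (uIcc x y) := by
    intro z hz
    have h1 := ((hasDerivAt_id z).sub_const x)
    have := ((h.mono hsub z hz).sub
      ((h1.mul_const (F₁ x)).hasDerivWithinAt (s := uIcc x y))).sub
      ((((h1.pow 2).div_const 2).mul_const (F₂ x)).hasDerivWithinAt (s := uIcc x y))
    refine this.congr_deriv ?_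
    simp
  have := key.abs_sub_le (convex_uIcc x y) (M := M * |y - x| ^ 2) (fun z hz =>
    (h₁.taylor_one h₂ hs hM hx (hsub hz)).trans
      (mul_le_mul_of_nonneg_left (pow_le_pow_left₀ (abs_nonneg _)
        (abs_sub_le_of_mem_uIcc hz) 2) hM0))
    left_mem_uIcc right_mem_uIcc
  calc _ = |F y - (y - x) * F₁ x - (y - x) ^ 2 / 2 * F₂ x
        - (F x - (x - x) * F₁ x - (x - x) ^ 2 / 2 * F₂ x)| := by congr 1; ring
    _ ≤ _ := this
    _ = _ := by ring

theorem DerivOn.taylor_three (h : DerivOn F F₁ s) (h₁ : DerivOn F₁ F₂ s) (h₂ : DerivOn F₂ F₃ s)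
    (h₃ : DerivOn F₃ F₄ s)
    (hs : Convex ℝ s) (hM : ∀ x ∈ s, |F₄ x| ≤ M) (hx : x ∈ s) (hy : y ∈ s) :
    |F y - F x - (y - x) * F₁ x - (y - x) ^ 2 / 2 * F₂ x - (y - x) ^ 3 / 6 * F₃ x|
      ≤ M * |y - x| ^ 4 := by
  have hsub := uIcc_subset_of_convex hs hx hy
  have hM0 : 0 ≤ M := (abs_nonneg _).trans (hM x hx)
  have key : DerivOn (fun z => F z - (z - x) * F₁ x - (z - x) ^ 2 / 2 * F₂ x
        - (z - x) ^ 3 / 6 * F₃ x)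
      (fun z => F₁ z - F₁ x - (z - x) * F₂ x - (z - x) ^ 2 / 2 * F₃ x) (uIcc x y) := by
    intro z hz
    have h1 := ((hasDerivAt_id z).sub_const x)
    have := (((h.mono hsub z hz).sub
      ((h1.mul_const (F₁ x)).hasDerivWithinAt (s := uIcc x y))).sub
      ((((h1.pow 2).div_const 2).mul_const (F₂ x)).hasDerivWithinAt (s := uIcc x y))).sub
      ((((h1.pow 3).div_const 6).mul_const (F₃ x)).hasDerivWithinAt (s := uIcc x y))
    refine this.congr_deriv ?_
    simp only [id, one_mul, mul_one]
    push_cast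
    ring
  have := key.abs_sub_le (convex_uIcc x y) (M := M * |y - x| ^ 3) (fun z hz =>
    (h₁.taylor_two h₂ h₃ hs hM hx (hsub hz)).trans
      (mul_le_mul_of_nonneg_left (pow_le_pow_left₀ (abs_nonneg _)
        (abs_sub_le_of_mem_uIcc hz) 3) hM0))
    left_mem_uIcc right_mem_uIcc
  calc _ = |F y - (y - x) * F₁ x - (y - x) ^ 2 / 2 * F₂ x - (y - x) ^ 3 / 6 * F₃ x
        - (F x - (x - x) * F₁ x - (x - x) ^ 2 / 2 * F₂ x - (x - x) ^ 3 / 6 * F₃ x)| := by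
          congr 1; ring
    _ ≤ _ := this
    _ = _ := by ring

theorem abs_sub_le_add {a b A B : ℝ} (ha : |a| ≤ A) (hb : |b| ≤ B) : |a - b| ≤ A + B :=
  (abs_sub a b).trans (add_le_add ha hb)

variable {τ : ℝ}

theorem DerivOn.symm_diff_one (h : DerivOn F F₁ s) (h₁ : DerivOn F₁ F₂ s) (hs : Convex ℝ s)
    (hM : ∀ x ∈ s, |F₂ x| ≤ M) (hτ : 0 ≤ τ) (hx : x ∈ s) (hl : x - τ ∈ s) (hr : x + τ ∈ s) :
    |F (x + τ) - F (x - τ) - 2 * τ * F₁ x| ≤ 2 * M * τ ^ 2 := by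
  have := abs_sub_le_add (h.taylor_one h₁ hs hM hx hr) (h.taylor_one h₁ hs hM hx hl)
  rw [show x + τ - x = τ by ring, show x - τ - x = -τ by ring, abs_neg, abs_of_nonneg hτ] at this
  calc _ = _ := by congr 1; ring
    _ ≤ _ := this
    _ = _ := by ring

/-- The quadratic Taylor terms at `x + τ` and `x - τ` cancel: the error is cubic although no `F₂`
term is subtracted. -/
theorem DerivOn.symm_diff_two (h : DerivOn F F₁ s) (h₁ : DerivOn F₁ F₂ s) (h₂ : DerivOn F₂ F₃ s)
    (hs : Convex ℝ s)
    (hM : ∀ x ∈ s, |F₃ x| ≤ M) (hτ : 0 ≤ τ) (hx : x ∈ s) (hl : x - τ ∈ s) (hr : x + τ ∈ s) :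
    |F (x + τ) - F (x - τ) - 2 * τ * F₁ x| ≤ 2 * M * τ ^ 3 := by
  have := abs_sub_le_add (h.taylor_two h₁ h₂ hs hM hx hr) (h.taylor_two h₁ h₂ hs hM hx hl)
  rw [show x + τ - x = τ by ring, show x - τ - x = -τ by ring, abs_neg, abs_of_nonneg hτ] at this
  calc _ = _ := by congr 1; ring
    _ ≤ _ := this
    _ = _ := by ring

theorem DerivOn.symm_diff_three (h : DerivOn F F₁ s) (h₁ : DerivOn F₁ F₂ s)
    (h₂ : DerivOn F₂ F₃ s) (h₃ : DerivOn F₃ F₄ s) (hs : Convex ℝ s)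
    (hM : ∀ x ∈ s, |F₄ x| ≤ M) (hτ : 0 ≤ τ) (hx : x ∈ s) (hl : x - τ ∈ s) (hr : x + τ ∈ s) :
    |F (x + τ) - F (x - τ) - 2 * τ * F₁ x - τ ^ 3 / 3 * F₃ x| ≤ 2 * M * τ ^ 4 := by
  have := abs_sub_le_add (h.taylor_three h₁ h₂ h₃ hs hM hx hr)
    (h.taylor_three h₁ h₂ h₃ hs hM hx hl)
  rw [show x + τ - x = τ by ring, show x - τ - x = -τ by ring, abs_neg, abs_of_nonneg hτ] at this
  calc _ = _ := by congr 1; ring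
    _ ≤ _ := this
    _ = _ := by ring

theorem DerivOn.mul_sub_le {c : ℝ} (h : DerivOn F F₁ s) (hs : Convex ℝ s) (hc : ∀ x ∈ s, c ≤ F₁ x)
    (hx : x ∈ s) (hy : y ∈ s) (hxy : x ≤ y) : c * (y - x) ≤ F y - F x := by
  have : MonotoneOn (fun z => F z - c * z) s := by
    refine monotoneOn_of_hasDerivWithinAt_nonneg (f' := fun z => F₁ z - c) hs
      (h.continuousOn.sub (by fun_prop)) (fun z hz => ?_)
      (fun z hz => sub_nonneg.2 (hc z (interior_subset hz)))
    have := ((h.mono interior_subset) z hz).sub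
      (((hasDerivAt_id z).const_mul c).hasDerivWithinAt (s := interior s))
    exact this.congr_deriv (by simp)
  have := this hx hy hxy
  simp only at this
  linarith

end Taylor

/-! ### Antiderivatives on the unit interval and sums over cells. -/

theorem exists_antiderivative {f : ℝ → ℝ} (hf : ContinuousOn f (Icc 0 1)) :
    ∃ F, DerivOn F f (Icc 0 1) := by
  -- The constant extension of `f` beyond `[0, 1]` is continuous on the line, so its primitive is
  -- differentiable at `0` and `1` too.
  refine ⟨fun x => ∫ y in (0 : ℝ)..x, IccExtend zero_le_one ((Icc 0 1).domRestrict f) y,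
    fun x hx => ?_⟩
  have hc : Continuous (IccExtend (zero_le_one (α := ℝ)) ((Icc 0 1).domRestrict f)) :=
    (continuousOn_iff_continuous_domRestrict.1 hf).Icc_extend'
  have := (hc.integral_hasStrictDerivAt 0 x).hasDerivAt.hasDerivWithinAt (s := Icc 0 1)
  refine this.congr_deriv ?_
  rw [IccExtend_of_mem _ _ hx]; rfl

theorem DerivOn.integral_eq {F f : ℝ → ℝ} (h : DerivOn F f (Icc 0 1))
    (hf : ContinuousOn f (Icc 0 1)) : ∫ x in (0 : ℝ)..1, f x = F 1 - F 0 := by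
  apply intervalIntegral.integral_eq_sub_of_hasDerivAt_of_le zero_le_one h.continuousOn
  · intro x hx
    exact (h x (Ioo_subset_Icc_self hx)).hasDerivAt (Icc_mem_nhds hx.1 hx.2)
  · exact (hf.mono (by rw [uIcc_of_le zero_le_one])).intervalIntegrable

/-- For `D = d` the points `h (i + D/2)` are the midpoints of the bonds between `d`-th neighbours.
Consecutive cells share an endpoint, so the sum telescopes. -/
theorem sum_cells (F : ℝ → ℝ) (h D : ℝ) (N : ℕ) :
    ∑ i ∈ Finset.range N, (F (h * (i + D / 2) + h / 2) - F (h * (i + D / 2) - h / 2))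
      = F (h * (N + (D - 1) / 2)) - F (h * ((D - 1) / 2)) := by
  have := Finset.sum_range_sub (fun i : ℕ => F (h * (i + (D - 1) / 2))) N
  rw [Nat.cast_zero, zero_add] at this
  rw [← this]
  refine Finset.sum_congr rfl fun i _ => ?_
  congr 2 <;> push_cast <;> ring

theorem abs_sum_range_le {g : ℕ → ℝ} {N n : ℕ} {B : ℝ} (hB : 0 ≤ B) (hN : N ≤ n)
    (hg : ∀ i < N, |g i| ≤ B) : |∑ i ∈ Finset.range N, g i| ≤ n * B := by
  refine (Finset.abs_sum_le_sum_abs _ _).trans ?_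
  refine (Finset.sum_le_card_nsmul _ _ B fun i hi => hg i (Finset.mem_range.1 hi)).trans ?_
  rw [Finset.card_range, nsmul_eq_mul]
  gcongr

/-! ### Potentials, chains and the energy density of `d`-th neighbours. -/

/-- `w 0, w 1, …` are the successive derivatives of a potential on the positive half-line, and
`w k y = O(β d / d ^ k)` for `y ≥ m d`. -/
structure DecayingPotential (w : ℕ → ℝ → ℝ) (m K : ℝ) (β : ℕ → ℝ) : Prop where
  m_pos : 0 < m
  K_nonneg : 0 ≤ K
  β_nonneg : ∀ d, 0 ≤ β d
  deriv : ∀ k y, 0 < y → HasDerivAt (w k) (w (k + 1) y) y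
  bound : ∀ k ≤ 3, ∀ d : ℕ, 1 ≤ d → ∀ y, m * d ≤ y → |w k y| * d ^ k ≤ K * β d

/-- `v 0, v 1, …` are the successive derivatives of a strictly increasing deformation of `[0, 1]`. -/
structure SmoothChain (v : ℕ → ℝ → ℝ) (m M : ℝ) : Prop where
  deriv : ∀ k, DerivOn (v k) (v (k + 1)) (Icc 0 1)
  lower : ∀ x ∈ Icc (0 : ℝ) 1, m ≤ v 1 x
  bound : ∀ k, 2 ≤ k → k ≤ 4 → ∀ x ∈ Icc (0 : ℝ) 1, |v k x| ≤ M
  one_le : 1 ≤ M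

/-- The energy density `W (d v'(x))` of the bonds between `d`-th neighbours. -/
def profile (w v : ℕ → ℝ → ℝ) (d : ℕ) (x : ℝ) : ℝ := w 0 (d * v 1 x)

/-- The first derivative of `profile`. -/
def profile₁ (w v : ℕ → ℝ → ℝ) (d : ℕ) (x : ℝ) : ℝ := d * w 1 (d * v 1 x) * v 2 x

/-- The second derivative of `profile`. -/
def profile₂ (w v : ℕ → ℝ → ℝ) (d : ℕ) (x : ℝ) : ℝ :=
  d ^ 2 * w 2 (d * v 1 x) * v 2 x ^ 2 + d * w 1 (d * v 1 x) * v 3 x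

/-- The third derivative of `profile`. -/
def profile₃ (w v : ℕ → ℝ → ℝ) (d : ℕ) (x : ℝ) : ℝ :=
  d ^ 3 * w 3 (d * v 1 x) * v 2 x ^ 3 + 3 * (d ^ 2 * w 2 (d * v 1 x) * (v 2 x * v 3 x))
    + d * w 1 (d * v 1 x) * v 4 x

/-- The second-order correction to the energy density of the bonds between `d`-th neighbours. -/
def correction (w v : ℕ → ℝ → ℝ) (d : ℕ) (x : ℝ) : ℝ :=
  d ^ 3 / 24 * (w 1 (d * v 1 x) * v 3 x) - profile₂ w v d x / 24

/-- The first derivative of `correction`. -/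
def correction₁ (w v : ℕ → ℝ → ℝ) (d : ℕ) (x : ℝ) : ℝ :=
  d ^ 3 / 24 * (d * w 2 (d * v 1 x) * v 2 x * v 3 x + w 1 (d * v 1 x) * v 4 x)
    - profile₃ w v d x / 24

/-- The energy of the bonds between `d`-th neighbours in a chain of `n + 1` atoms. -/
def bondSum (w v : ℕ → ℝ → ℝ) (d n : ℕ) (h : ℝ) : ℝ :=
  ∑ i ∈ Finset.range (n + 1 - d), w 0 ((v 0 (h * (i + d)) - v 0 (h * i)) / h)

/-- The rescaled error of the first-order expansion of `bondSum`. -/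
def bondRemainder (w v : ℕ → ℝ → ℝ) (d n : ℕ) (h : ℝ) : ℝ :=
  (bondSum w v d n h - (1 / h) * (∫ x in (0 : ℝ)..1, profile w v d x)
    + (d - 1) / 2 * profile w v d 0 + ((1 - h * n) / h + (d - 1) / 2) * profile w v d 1) / h

section Profile

variable {w v : ℕ → ℝ → ℝ} {m K M : ℝ} {β : ℕ → ℝ} {d : ℕ}

theorem DecayingPotential.Kβ_nonneg (P : DecayingPotential w m K β) (d : ℕ) : 0 ≤ K * β d :=
  mul_nonneg P.K_nonneg (P.β_nonneg d)

theorem DecayingPotential.abs_le (P : DecayingPotential w m K β) {k : ℕ} (hk : k ≤ 3) (hd : 1 ≤ d)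
    {y : ℝ} (hy : m * d ≤ y) : |w k y| ≤ K * β d := by
  refine le_trans ?_ (P.bound k hk d hd y hy)
  exact le_mul_of_one_le_right (abs_nonneg _) (one_le_pow₀ (by exact_mod_cast hd))

theorem SmoothChain.arg_ge (C : SmoothChain v m M) (d : ℕ) {x : ℝ} (hx : x ∈ Icc (0 : ℝ) 1) :
    m * d ≤ d * v 1 x := by
  rw [mul_comm]; exact mul_le_mul_of_nonneg_left (C.lower x hx) (Nat.cast_nonneg d)

theorem DecayingPotential.md_pos (P : DecayingPotential w m K β) (hd : 1 ≤ d) : 0 < m * d :=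
  mul_pos P.m_pos (by exact_mod_cast hd)

theorem DecayingPotential.derivOn (P : DecayingPotential w m K β) (hd : 1 ≤ d) (k : ℕ) :
    DerivOn (w k) (w (k + 1)) (Ici (m * d)) :=
  fun y hy => (P.deriv k y ((P.md_pos hd).trans_le hy)).hasDerivWithinAt

theorem derivOn_comp (P : DecayingPotential w m K β) (C : SmoothChain v m M) (hd : 1 ≤ d) (k : ℕ) :
    DerivOn (fun x => w k (d * v 1 x)) (fun x => d * w (k + 1) (d * v 1 x) * v 2 x) (Icc 0 1) := by
  intro x hx
  have h := (P.deriv k (d * v 1 x) ((P.md_pos hd).trans_le (C.arg_ge d hx))).comp_hasDerivWithinAt x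
    ((C.deriv 1 x hx).const_mul (d : ℝ))
  refine h.congr_deriv ?_
  ring

theorem derivOn_profile (P : DecayingPotential w m K β) (C : SmoothChain v m M) (hd : 1 ≤ d) :
    DerivOn (profile w v d) (profile₁ w v d) (Icc 0 1) := derivOn_comp P C hd 0

theorem derivOn_profile₁ (P : DecayingPotential w m K β) (C : SmoothChain v m M) (hd : 1 ≤ d) :
    DerivOn (profile₁ w v d) (profile₂ w v d) (Icc 0 1) := by
  intro x hx
  have h := (((derivOn_comp P C hd 1 x hx).const_mul (d : ℝ))).mul (C.deriv 2 x hx)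
  refine h.congr_deriv ?_
  simp only [profile₂]
  ring

theorem derivOn_profile₂ (P : DecayingPotential w m K β) (C : SmoothChain v m M) (hd : 1 ≤ d) :
    DerivOn (profile₂ w v d) (profile₃ w v d) (Icc 0 1) := by
  intro x hx
  have h := (((derivOn_comp P C hd 2 x hx).const_mul ((d : ℝ) ^ 2)).mul
    ((C.deriv 2 x hx).pow 2)).add
    (((derivOn_comp P C hd 1 x hx).const_mul (d : ℝ)).mul (C.deriv 3 x hx))
  refine h.congr_deriv ?_
  simp only [profile₃, Pi.pow_apply]
  push_cast
  ring

theorem derivOn_correction (P : DecayingPotential w m K β) (C : SmoothChain v m M) (hd : 1 ≤ d) :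
    DerivOn (correction w v d) (correction₁ w v d) (Icc 0 1) := by
  intro x hx
  have h := (((derivOn_comp P C hd 1 x hx).mul (C.deriv 3 x hx)).const_mul ((d : ℝ) ^ 3 / 24)).sub
    ((derivOn_profile₂ P C hd x hx).div_const 24)
  exact h

theorem continuousOn_correction₁ (P : DecayingPotential w m K β) (C : SmoothChain v m M)
    (hd : 1 ≤ d) : ContinuousOn (correction₁ w v d) (Icc 0 1) := by
  have aux : ∀ (c : ℝ) (a₁ a₂ a₃ b₂ b₃ b₄ : ℝ → ℝ), ContinuousOn a₁ (Icc (0 : ℝ) 1) →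
      ContinuousOn a₂ (Icc (0 : ℝ) 1) → ContinuousOn a₃ (Icc (0 : ℝ) 1) →
      ContinuousOn b₂ (Icc (0 : ℝ) 1) → ContinuousOn b₃ (Icc (0 : ℝ) 1) →
      ContinuousOn b₄ (Icc (0 : ℝ) 1) →
      ContinuousOn (fun x => c ^ 3 / 24 * (c * a₂ x * b₂ x * b₃ x + a₁ x * b₄ x)
        - (c ^ 3 * a₃ x * b₂ x ^ 3 + 3 * (c ^ 2 * a₂ x * (b₂ x * b₃ x)) + c * a₁ x * b₄ x) / 24)
        (Icc (0 : ℝ) 1) := by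
    intros
    simp only [div_eq_mul_inv]
    fun_prop
  exact aux d _ _ _ _ _ _ (derivOn_comp P C hd 1).continuousOn (derivOn_comp P C hd 2).continuousOn
    (derivOn_comp P C hd 3).continuousOn (C.deriv 2).continuousOn (C.deriv 3).continuousOn
    (C.deriv 4).continuousOn

theorem abs_profile_le (P : DecayingPotential w m K β) (C : SmoothChain v m M) (hd : 1 ≤ d)
    {x : ℝ} (hx : x ∈ Icc (0 : ℝ) 1) : |profile w v d x| ≤ K * β d :=
  P.abs_le (k := 0) (by norm_num) hd (C.arg_ge d hx)

/-- Every factor `d` produced by the chain rule is paid for by the decay of the derivative of `w`,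
so the bound does not grow with the order. The constant `5 * M ^ 3` serves all three derivatives;
the third one needs it, having coefficients `1 + 3 + 1`. -/
theorem abs_profile₁_le (P : DecayingPotential w m K β) (C : SmoothChain v m M) (hd : 1 ≤ d)
    {x : ℝ} (hx : x ∈ Icc (0 : ℝ) 1) : |profile₁ w v d x| ≤ K * β d * (5 * M ^ 3) := by
  have h1 := P.bound 1 (by norm_num) d hd _ (C.arg_ge d hx)
  have g2 := C.bound 2 le_rfl (by norm_num) x hx
  have hM := C.one_le
  have hM3 : M ≤ M ^ 3 := le_self_pow₀ hM (by norm_num)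
  have := P.Kβ_nonneg d
  rw [profile₁, abs_mul, abs_mul, Nat.abs_cast]
  calc _ = |w 1 (d * v 1 x)| * d ^ 1 * |v 2 x| := by ring
    _ ≤ (K * β d) * M := by gcongr
    _ ≤ _ := by gcongr; linarith

theorem abs_profile₂_le (P : DecayingPotential w m K β) (C : SmoothChain v m M) (hd : 1 ≤ d)
    {x : ℝ} (hx : x ∈ Icc (0 : ℝ) 1) : |profile₂ w v d x| ≤ K * β d * (5 * M ^ 3) := by
  have h1 := P.bound 1 (by norm_num) d hd _ (C.arg_ge d hx)
  have h2 := P.bound 2 (by norm_num) d hd _ (C.arg_ge d hx)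
  have g2 := C.bound 2 le_rfl (by norm_num) x hx
  have g3 := C.bound 3 (by norm_num) (by norm_num) x hx
  have hM := C.one_le
  have hM3 : M ≤ M ^ 3 := le_self_pow₀ hM (by norm_num)
  have hM2 : M ^ 2 ≤ M ^ 3 := pow_le_pow_right₀ hM (by norm_num)
  have := P.Kβ_nonneg d
  rw [profile₂]
  refine (abs_add_le _ _).trans ?_
  simp only [abs_mul, abs_pow, Nat.abs_cast]
  calc _ = |w 2 (d * v 1 x)| * d ^ 2 * |v 2 x| ^ 2 + |w 1 (d * v 1 x)| * d ^ 1 * |v 3 x| := by ring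
    _ ≤ (K * β d) * M ^ 2 + (K * β d) * M := by gcongr
    _ = (K * β d) * (M ^ 2 + M) := by ring
    _ ≤ _ := by gcongr; linarith

theorem abs_profile₃_le (P : DecayingPotential w m K β) (C : SmoothChain v m M) (hd : 1 ≤ d)
    {x : ℝ} (hx : x ∈ Icc (0 : ℝ) 1) : |profile₃ w v d x| ≤ K * β d * (5 * M ^ 3) := by
  have h1 := P.bound 1 (by norm_num) d hd _ (C.arg_ge d hx)
  have h2 := P.bound 2 (by norm_num) d hd _ (C.arg_ge d hx)
  have h3 := P.bound 3 (by norm_num) d hd _ (C.arg_ge d hx)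
  have g2 := C.bound 2 le_rfl (by norm_num) x hx
  have g3 := C.bound 3 (by norm_num) (by norm_num) x hx
  have g4 := C.bound 4 (by norm_num) (by norm_num) x hx
  have hM := C.one_le
  have hM3 : M ≤ M ^ 3 := le_self_pow₀ hM (by norm_num)
  have hM2 : M ^ 2 ≤ M ^ 3 := pow_le_pow_right₀ hM (by norm_num)
  have := P.Kβ_nonneg d
  rw [profile₃]
  refine (abs_add_three _ _ _).trans ?_
  simp only [abs_mul, abs_pow, Nat.abs_cast, Nat.abs_ofNat]
  calc _ = |w 3 (d * v 1 x)| * d ^ 3 * |v 2 x| ^ 3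
        + 3 * (|w 2 (d * v 1 x)| * d ^ 2 * (|v 2 x| * |v 3 x|))
        + |w 1 (d * v 1 x)| * d ^ 1 * |v 4 x| := by ring
    _ ≤ (K * β d) * M ^ 3 + 3 * ((K * β d) * (M * M)) + (K * β d) * M := by gcongr
    _ = (K * β d) * (M ^ 3 + 3 * M ^ 2 + M) := by ring
    _ ≤ _ := by gcongr; linarith

end Profile

/-! ### A bound for the remainder, uniform in the lattice spacing. -/

section Bonds

variable {w v : ℕ → ℝ → ℝ} {m K M : ℝ} {β : ℕ → ℝ} {d n i : ℕ} {h : ℝ}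

theorem cell_mem (hh : 0 < h) (hn : h * n ≤ 1) (hi : i + d ≤ n) {t : ℝ}
    (ht : |t| ≤ d / 2) : h * (i + d / 2) + h * t ∈ Icc (0 : ℝ) 1 := by
  have hid : (i : ℝ) + d ≤ n := by exact_mod_cast hi
  have hi0 : (0 : ℝ) ≤ i := i.cast_nonneg
  obtain ⟨h1, h2⟩ := abs_le.1 ht
  rw [← mul_add]
  constructor
  · exact mul_nonneg hh.le (by linarith)
  · exact (mul_le_mul_of_nonneg_left (by linarith) hh.le).trans hn

/-- Lower bound and expansions of the strain of a bond. -/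
theorem bond_arg (C : SmoothChain v m M)
    (hh : 0 < h) (hn : h * n ≤ 1) (hi : i + d ≤ n) :
    m * d ≤ (v 0 (h * (i + d)) - v 0 (h * i)) / h ∧
    |(v 0 (h * (i + d)) - v 0 (h * i)) / h - d * v 1 (h * (i + d / 2))| ≤ M * d ^ 3 / 4 * h ^ 2 ∧
    |(v 0 (h * (i + d)) - v 0 (h * i)) / h - d * v 1 (h * (i + d / 2))
      - h ^ 2 * d ^ 3 / 24 * v 3 (h * (i + d / 2))| ≤ M * d ^ 4 / 8 * h ^ 3 := by
  have hd0 : (0 : ℝ) ≤ d := d.cast_nonneg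
  have e1 : h * ((i : ℝ) + d) = h * (i + d / 2) + h * d / 2 := by ring
  have e2 : h * (i : ℝ) = h * (i + d / 2) - h * d / 2 := by ring
  have hx : h * (i + (d : ℝ) / 2) ∈ Icc (0 : ℝ) 1 := by
    simpa using cell_mem hh hn hi (t := 0) (by simp; positivity)
  have hr : h * (i + (d : ℝ) / 2) + h * d / 2 ∈ Icc (0 : ℝ) 1 := by
    simpa [mul_div_assoc] using cell_mem hh hn hi (t := d / 2) (by rw [abs_of_nonneg]; positivity)
  have hl : h * (i + (d : ℝ) / 2) - h * d / 2 ∈ Icc (0 : ℝ) 1 := by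
    have := cell_mem hh hn hi (t := -(d / 2)) (by rw [abs_neg, abs_of_nonneg]; positivity)
    convert this using 1; ring
  rw [e1, e2]
  set x := h * (i + (d : ℝ) / 2)
  have hτ : 0 ≤ h * d / 2 := by positivity
  have cv : Convex ℝ (Icc (0 : ℝ) 1) := convex_Icc 0 1
  refine ⟨?_, ?_, ?_⟩
  · rw [le_div_iff₀ hh]
    have := (C.deriv 0).mul_sub_le cv C.lower hl hr (by linarith)
    linarith
  · have := (C.deriv 0).symm_diff_two (C.deriv 1) (C.deriv 2) cv
      (C.bound 3 (by norm_num) (by norm_num)) hτ hx hl hr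
    have e : (v 0 (x + h * d / 2) - v 0 (x - h * d / 2)) / h - d * v 1 x
      = (v 0 (x + h * d / 2) - v 0 (x - h * d / 2) - 2 * (h * d / 2) * v 1 x) / h := by
      field_simp
    rw [e, abs_div, abs_of_pos hh, div_le_iff₀ hh]
    calc _ ≤ _ := this
      _ = _ := by ring
  · have := (C.deriv 0).symm_diff_three (C.deriv 1) (C.deriv 2) (C.deriv 3) cv
      (C.bound 4 (by norm_num) (by norm_num)) hτ hx hl hr
    have e : (v 0 (x + h * d / 2) - v 0 (x - h * d / 2)) / h - d * v 1 x
        - h ^ 2 * d ^ 3 / 24 * v 3 x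
      = (v 0 (x + h * d / 2) - v 0 (x - h * d / 2) - 2 * (h * d / 2) * v 1 x
        - (h * d / 2) ^ 3 / 3 * v 3 x) / h := by
      field_simp
      ring
    rw [e, abs_div, abs_of_pos hh, div_le_iff₀ hh]
    calc _ ≤ _ := this
      _ = _ := by ring

/-- After telescoping the cells, the terms in `profile w v d 0` and `profile w v d 1` turn the two
end pieces into first-order Taylor remainders of `F` at `0` and `1`. What is left is the difference
between bonds and cell means. -/
theorem bondRemainder_eq {F : ℝ → ℝ} (hF : DerivOn F (profile w v d) (Icc 0 1))
    (hc : ContinuousOn (profile w v d) (Icc 0 1)) (hh : 0 < h) (hdn : d ≤ n) :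
    bondRemainder w v d n h =
      (∑ i ∈ Finset.range (n + 1 - d), (w 0 ((v 0 (h * (i + d)) - v 0 (h * i)) / h)
        - (F (h * (i + d / 2) + h / 2) - F (h * (i + d / 2) - h / 2)) / h)) / h
      - (F (h * ((d - 1) / 2)) - F 0 - (h * ((d - 1) / 2) - 0) * profile w v d 0) / h ^ 2
      + (F (h * (n - (d - 1) / 2)) - F 1 - (h * (n - (d - 1) / 2) - 1) * profile w v d 1)
        / h ^ 2 := by
  rw [Finset.sum_sub_distrib, ← Finset.sum_div, sum_cells, bondRemainder, hF.integral_eq hc,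
    bondSum]
  have e : (((n + 1 - d : ℕ) : ℝ) + (d - 1) / 2) = n - (d - 1) / 2 := by
    rw [Nat.cast_sub (by omega)]; push_cast; ring
  rw [e]
  field_simp
  ring

theorem ends_mem (hd : 1 ≤ d) (hh : 0 < h) (hn : h * n ≤ 1) (hdn : d ≤ n) :
    h * ((d - 1) / 2) ∈ Icc (0 : ℝ) 1 ∧ h * (n - ((d : ℝ) - 1) / 2) ∈ Icc (0 : ℝ) 1 := by
  have hd1 : (1 : ℝ) ≤ d := by exact_mod_cast hd
  have hdn' : (d : ℝ) ≤ n := by exact_mod_cast hdn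
  refine ⟨⟨mul_nonneg hh.le (by linarith), ?_⟩, ⟨mul_nonneg hh.le (by linarith), ?_⟩⟩
  · exact (mul_le_mul_of_nonneg_left (by linarith) hh.le).trans hn
  · exact (mul_le_mul_of_nonneg_left (by linarith) hh.le).trans hn

theorem ends_abs_le (hd : 1 ≤ d) (hh : 0 < h) (hn : h * n ≤ 1) (hn' : 1 < h * (n + 1)) :
    |h * (((d : ℝ) - 1) / 2) - 0| ≤ h * d ∧ |h * (n - ((d : ℝ) - 1) / 2) - 1| ≤ h * d := by
  have hd1 : (1 : ℝ) ≤ d := by exact_mod_cast hd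
  constructor <;> rw [abs_le] <;> constructor <;> nlinarith

theorem cell_half_mem (hd : 1 ≤ d) (hh : 0 < h) (hn : h * n ≤ 1) (hi : i + d ≤ n) :
    h * (i + (d : ℝ) / 2) ∈ Icc (0 : ℝ) 1 ∧ h * (i + (d : ℝ) / 2) - h / 2 ∈ Icc (0 : ℝ) 1 ∧
      h * (i + (d : ℝ) / 2) + h / 2 ∈ Icc (0 : ℝ) 1 := by
  have hd1 : (1 : ℝ) ≤ d := by exact_mod_cast hd
  refine ⟨?_, ?_, ?_⟩
  · simpa using cell_mem hh hn hi (t := 0) (by simp; positivity)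
  · have := cell_mem hh hn hi (t := -(1 / 2)) (by rw [abs_neg, abs_of_nonneg] <;> linarith)
    convert this using 1; ring
  · have := cell_mem hh hn hi (t := 1 / 2) (by rw [abs_of_nonneg] <;> linarith)
    convert this using 1; ring

theorem abs_bond_sub_cell_le (P : DecayingPotential w m K β) (C : SmoothChain v m M)
    (hd : 1 ≤ d) (hh : 0 < h) (hn : h * n ≤ 1) (hi : i + d ≤ n)
    {F : ℝ → ℝ} (hF : DerivOn F (profile w v d) (Icc 0 1)) :
    |w 0 ((v 0 (h * (i + d)) - v 0 (h * i)) / h)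
        - (F (h * (i + d / 2) + h / 2) - F (h * (i + d / 2) - h / 2)) / h|
      ≤ K * β d * (4 * M ^ 3) * d ^ 2 * h ^ 2 := by
  obtain ⟨hy, hy2, -⟩ := bond_arg C hh hn hi
  obtain ⟨hx, hl, hr⟩ := cell_half_mem hd hh hn hi
  set x := h * (i + (d : ℝ) / 2)
  set y := (v 0 (h * (i + d)) - v 0 (h * i)) / h
  have cv : Convex ℝ (Icc (0 : ℝ) 1) := convex_Icc 0 1
  have hd1 : (1 : ℝ) ≤ d := by exact_mod_cast hd
  have hM := C.one_le
  have hM3 : M ≤ M ^ 3 := le_self_pow₀ hM (by norm_num)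
  have hK := P.Kβ_nonneg d
  -- The decay of `w 1` gains a factor `1/d`, which lowers the `d³` of the strain error to the
  -- summable `d²`.
  have b1 : |w 0 y - w 0 (d * v 1 x)| ≤ K * β d / d * (M * d ^ 3 / 4 * h ^ 2) := by
    refine ((P.derivOn hd 0).abs_sub_le (convex_Ici _) (M := K * β d / d) (fun z hz => ?_)
      (C.arg_ge d hx) hy).trans ?_
    · rw [le_div_iff₀ (by linarith)]
      simpa using P.bound 1 (by norm_num) d hd z hz
    · gcongr
  have b2 := hF.symm_diff_two (derivOn_profile P C hd) (derivOn_profile₁ P C hd) cv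
    (fun x hx => abs_profile₂_le P C hd hx) (by positivity : 0 ≤ h / 2) hx hl hr
  have b3 : |w 0 (d * v 1 x) - (F (x + h / 2) - F (x - h / 2)) / h|
      ≤ K * β d * (5 * M ^ 3) / 4 * h ^ 2 := by
    have e : w 0 (d * v 1 x) - (F (x + h / 2) - F (x - h / 2)) / h
        = -(F (x + h / 2) - F (x - h / 2) - 2 * (h / 2) * profile w v d x) / h := by
      rw [profile]; field_simp; ring
    rw [e, abs_div, abs_of_pos hh, abs_neg, div_le_iff₀ hh]
    calc _ ≤ _ := b2
      _ = _ := by ring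
  calc _ = |(w 0 y - w 0 (d * v 1 x))
        + (w 0 (d * v 1 x) - (F (x + h / 2) - F (x - h / 2)) / h)| := by congr 1; ring
    _ ≤ _ := (abs_add_le _ _).trans (add_le_add b1 b3)
    _ = K * β d * (M * d ^ 2 / 4 + 5 * M ^ 3 / 4) * h ^ 2 := by
      field_simp
    _ ≤ K * β d * (M ^ 3 * d ^ 2 / 4 + 5 * M ^ 3 * d ^ 2 / 4) * h ^ 2 := by
      have : M ^ 3 * 1 ≤ M ^ 3 * d ^ 2 := by gcongr; exact one_le_pow₀ hd1
      refine mul_le_mul_of_nonneg_right (mul_le_mul_of_nonneg_left ?_ hK) (sq_nonneg h)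
      have : M * d ^ 2 ≤ M ^ 3 * d ^ 2 := by gcongr
      linarith
    _ ≤ K * β d * (4 * M ^ 3 * d ^ 2) * h ^ 2 := by
      have : 0 ≤ M ^ 3 * d ^ 2 := by positivity
      gcongr; linarith
    _ = _ := by ring

/-- This is the majorant for dominated convergence in `d`, so it must hold for every `d`, also when
the chain is too short to have such bonds. There are at most `n ≤ 1/h` bonds, each with error
`O(h²)`, and each end contributes `(h d)²`. -/
theorem abs_bondRemainder_le (P : DecayingPotential w m K β) (C : SmoothChain v m M)
    (hd : 1 ≤ d) (hh : 0 < h) (hn : h * n ≤ 1) (hn' : 1 < h * (n + 1)) :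
    |bondRemainder w v d n h| ≤ 14 * K * M ^ 3 * (β d * d ^ 2) := by
  have hfc := (derivOn_profile P C hd).continuousOn
  obtain ⟨F, hF⟩ := exists_antiderivative hfc
  have cv : Convex ℝ (Icc (0 : ℝ) 1) := convex_Icc 0 1
  have z0 : (0 : ℝ) ∈ Icc (0 : ℝ) 1 := by simp
  have z1 : (1 : ℝ) ∈ Icc (0 : ℝ) 1 := by simp
  have hM := C.one_le
  have hM3 : 1 ≤ M ^ 3 := one_le_pow₀ hM
  have hK := P.Kβ_nonneg d
  have hd1 : (1 : ℝ) ≤ d := by exact_mod_cast hd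
  by_cases hdn : d ≤ n
  · rw [bondRemainder_eq hF hfc hh hdn]
    obtain ⟨m0, m1⟩ := ends_mem hd hh hn hdn
    obtain ⟨l0, l1⟩ := ends_abs_le hd hh hn hn'
    have c1 := hF.taylor_one (derivOn_profile P C hd) cv (fun x hx => abs_profile₁_le P C hd hx)
      z0 m0
    have c2 := hF.taylor_one (derivOn_profile P C hd) cv (fun x hx => abs_profile₁_le P C hd hx)
      z1 m1
    have c3 := abs_sum_range_le (n := n) (by positivity) (by omega : n + 1 - d ≤ n)
      (fun i hi => abs_bond_sub_cell_le P C hd hh hn (by omega : i + d ≤ n) hF)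
    have c1' : |(F (h * ((d - 1) / 2)) - F 0 - (h * ((d - 1) / 2) - 0) * profile w v d 0) / h ^ 2|
        ≤ K * β d * (5 * M ^ 3) * d ^ 2 := by
      rw [abs_div, abs_of_pos (pow_pos hh 2), div_le_iff₀ (by positivity)]
      calc _ ≤ _ := c1
        _ ≤ K * β d * (5 * M ^ 3) * (h * d) ^ 2 := by gcongr
        _ = _ := by ring
    have c2' : |(F (h * (n - (d - 1) / 2)) - F 1
        - (h * (n - (d - 1) / 2) - 1) * profile w v d 1) / h ^ 2|
        ≤ K * β d * (5 * M ^ 3) * d ^ 2 := by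
      rw [abs_div, abs_of_pos (pow_pos hh 2), div_le_iff₀ (by positivity)]
      calc _ ≤ _ := c2
        _ ≤ K * β d * (5 * M ^ 3) * (h * d) ^ 2 := by gcongr
        _ = _ := by ring
    have c3' : |(∑ i ∈ Finset.range (n + 1 - d), (w 0 ((v 0 (h * (i + d)) - v 0 (h * i)) / h)
        - (F (h * (i + d / 2) + h / 2) - F (h * (i + d / 2) - h / 2)) / h)) / h|
        ≤ K * β d * (4 * M ^ 3) * d ^ 2 := by
      rw [abs_div, abs_of_pos hh, div_le_iff₀ hh]
      calc _ ≤ _ := c3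
        _ = (K * β d * (4 * M ^ 3) * d ^ 2 * h) * (h * n) := by ring
        _ ≤ (K * β d * (4 * M ^ 3) * d ^ 2 * h) * 1 := by gcongr
        _ = _ := by ring
    -- The constant is `14 = 4 + 5 + 5`: the cells and the two ends.
    calc _ ≤ _ := (abs_add_le _ _).trans (add_le_add (abs_sub_le_add c3' c1') c2')
      _ = _ := by ring
  -- There are no bonds here. The subtracted terms are bounded separately, each by a multiple of `d
  -- * (K * β d)`, and `1 / h ≤ d` pays for the division by `h`.
  · have hN : n + 1 - d = 0 := by omega
    have hnd : (n : ℝ) + 1 ≤ d := by exact_mod_cast (by omega : n + 1 ≤ d)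
    have hinv : 1 / h ≤ d := by
      rw [div_le_iff₀ hh]; nlinarith
    have hs : |(1 - h * n) / h| ≤ 1 := by
      rw [abs_div, abs_of_pos hh, div_le_one hh, abs_le]; constructor <;> linarith
    rw [bondRemainder, bondSum, hN, Finset.range_zero, Finset.sum_empty, hF.integral_eq hfc]
    have c0 : |1 / h * (F 1 - F 0)| ≤ d * (K * β d * |1 - 0|) := by
      rw [abs_mul, abs_of_pos (by positivity : 0 < 1 / h)]
      have := hF.abs_sub_le cv (fun x hx => abs_profile_le P C hd hx) z0 z1
      gcongr
    have c1 : |((d : ℝ) - 1) / 2 * profile w v d 0| ≤ d / 2 * (K * β d) := by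
      rw [abs_mul, abs_of_nonneg (by linarith : 0 ≤ ((d : ℝ) - 1) / 2)]
      have := abs_profile_le P C hd z0
      gcongr; linarith
    have c2 : |((1 - h * n) / h + ((d : ℝ) - 1) / 2) * profile w v d 1|
        ≤ (1 + d / 2) * (K * β d) := by
      rw [abs_mul]
      have := abs_profile_le P C hd z1
      have h2 : |(1 - h * n) / h + ((d : ℝ) - 1) / 2| ≤ 1 + d / 2 := by
        refine (abs_add_le _ _).trans (add_le_add hs ?_)
        rw [abs_of_nonneg] <;> linarith
      gcongr
    rw [div_eq_mul_one_div, abs_mul, abs_of_pos (by positivity : 0 < 1 / h)]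
    have c3 := (abs_add_le (0 - 1 / h * (F 1 - F 0) + (d - 1) / 2 * profile w v d 0)
      (((1 - h * n) / h + ((d : ℝ) - 1) / 2) * profile w v d 1)).trans
      (add_le_add ((abs_add_le _ _).trans (add_le_add
        ((congrArg _ (zero_sub _)).trans_le ((abs_neg _).trans_le c0)) c1)) c2)
    calc _ ≤ (d * (K * β d * |1 - 0|) + d / 2 * (K * β d) + (1 + d / 2) * (K * β d)) * d := by
          gcongr
      _ = (K * β d) * (2 * d + 1) * d := by rw [sub_zero, abs_one]; ring
      _ ≤ (K * β d) * (2 * d + d) * d := by gcongr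
      _ = 3 * 1 * ((K * β d) * d ^ 2) := by ring
      _ ≤ 14 * M ^ 3 * ((K * β d) * d ^ 2) := by gcongr; norm_num
      _ = _ := by ring

end Bonds

/-! ### Limit of the remainder for fixed `d`, and summation over `d`. -/

/-- The limit of `bondRemainder` when the last atom is at distance `a h + o(h)` from the end. -/
def bondLimit (w v : ℕ → ℝ → ℝ) (a : ℝ) (d : ℕ) : ℝ :=
  (∫ x in (0 : ℝ)..1, correction w v d x) - (((d : ℝ) - 1) / 2) ^ 2 / 2 * profile₁ w v d 0
    + (a + (d - 1) / 2) ^ 2 / 2 * profile₁ w v d 1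

/-- Lattice spacings `h q → 0` and numbers of bonds `n q`, such that the last atom is at distance
`a h + o(h)` from the end of `[0, 1]`. -/
structure LatticeSeq (h : ℕ → ℝ) (n : ℕ → ℕ) (a : ℝ) : Prop where
  pos : ∀ q, 0 < h q
  le : ∀ᶠ q in atTop, h q * n q ≤ 1
  lt : ∀ q, 1 < h q * (n q + 1)
  lim : Tendsto h atTop (𝓝 0)
  gap : Tendsto (fun q => (1 - h q * n q) / h q) atTop (𝓝 a)

section Limit

variable {w v : ℕ → ℝ → ℝ} {m K M : ℝ} {β : ℕ → ℝ} {d : ℕ}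

/-- One order beyond `abs_bond_sub_cell_le`: the `h²` terms of the strain and of the cell mean add
up to `h² * correction`, here replaced by `h` times its integral over the cell so that it telescopes
as well. The constant may depend on `d`, because only a limit for fixed `d` is needed. -/
theorem exists_bond_sub_cell_expansion (P : DecayingPotential w m K β) (C : SmoothChain v m M)
    (hd : 1 ≤ d) {F Φ : ℝ → ℝ} (hF : DerivOn F (profile w v d) (Icc 0 1))
    (hΦ : DerivOn Φ (correction w v d) (Icc 0 1)) :
    ∃ B, 0 ≤ B ∧ ∀ (h : ℝ) (n i : ℕ), 0 < h → h ≤ 1 → h * n ≤ 1 → i + d ≤ n →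
      |w 0 ((v 0 (h * (i + d)) - v 0 (h * i)) / h)
        - (F (h * (i + d / 2) + h / 2) - F (h * (i + d / 2) - h / 2)) / h
        - h * (Φ (h * (i + d / 2) + h / 2) - Φ (h * (i + d / 2) - h / 2))| ≤ B * h ^ 3 := by
  obtain ⟨B₁, hB₁⟩ := isCompact_Icc.exists_bound_of_continuousOn (continuousOn_correction₁ P C hd)
  have hB₁0 : 0 ≤ B₁ := (norm_nonneg _).trans (hB₁ 0 (by simp))
  have hM := C.one_le
  have hK := P.Kβ_nonneg d
  refine ⟨K * β d * (M * d ^ 3 / 4) ^ 2 + K * β d * (M * d ^ 4 / 8)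
    + 2 * (K * β d * (5 * M ^ 3)) / 16 + B₁ / 2, by positivity, ?_⟩
  intro h n i hh h1 hn hi
  obtain ⟨hy, hy2, hy3⟩ := bond_arg C hh hn hi
  obtain ⟨hx, hl, hr⟩ := cell_half_mem hd hh hn hi
  set x := h * (i + (d : ℝ) / 2)
  set y := (v 0 (h * (i + d)) - v 0 (h * i)) / h
  have cv : Convex ℝ (Icc (0 : ℝ) 1) := convex_Icc 0 1
  have hh2 : 0 ≤ h / 2 := by positivity
  have b1 := (P.derivOn hd 0).taylor_one (P.derivOn hd 1) (convex_Ici _)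
    (fun z hz => P.abs_le (k := 2) (by norm_num) hd hz) (C.arg_ge d hx) hy
  have b1' : |w 0 y - w 0 (d * v 1 x) - (y - d * v 1 x) * w 1 (d * v 1 x)|
      ≤ K * β d * (M * d ^ 3 / 4) ^ 2 * h ^ 3 := by
    calc _ ≤ _ := b1
      _ ≤ K * β d * (M * d ^ 3 / 4 * h ^ 2) ^ 2 := by gcongr
      _ = K * β d * (M * d ^ 3 / 4) ^ 2 * h ^ 3 * h := by ring
      _ ≤ K * β d * (M * d ^ 3 / 4) ^ 2 * h ^ 3 * 1 := by gcongr
      _ = _ := mul_one _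
  have b2 : |(y - d * v 1 x - h ^ 2 * d ^ 3 / 24 * v 3 x) * w 1 (d * v 1 x)|
      ≤ K * β d * (M * d ^ 4 / 8) * h ^ 3 := by
    rw [abs_mul]
    calc _ ≤ (M * d ^ 4 / 8 * h ^ 3) * (K * β d) := by
          gcongr
          exact P.abs_le (k := 1) (by norm_num) hd (C.arg_ge d hx)
      _ = _ := by ring
  have b3 := hF.symm_diff_three (derivOn_profile P C hd) (derivOn_profile₁ P C hd)
    (derivOn_profile₂ P C hd) cv (fun x hx => abs_profile₃_le P C hd hx) hh2 hx hl hr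
  have b3' : |(F (x + h / 2) - F (x - h / 2) - 2 * (h / 2) * profile w v d x
      - (h / 2) ^ 3 / 3 * profile₂ w v d x) / h|
      ≤ 2 * (K * β d * (5 * M ^ 3)) / 16 * h ^ 3 := by
    rw [abs_div, abs_of_pos hh, div_le_iff₀ hh]
    calc _ ≤ _ := b3
      _ = _ := by ring
  have b4 := hΦ.symm_diff_one (derivOn_correction P C hd) cv hB₁ hh2 hx hl hr
  have b4' : |h * (Φ (x + h / 2) - Φ (x - h / 2) - 2 * (h / 2) * correction w v d x)|
      ≤ B₁ / 2 * h ^ 3 := by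
    rw [abs_mul, abs_of_pos hh]
    calc _ ≤ h * (2 * B₁ * (h / 2) ^ 2) := by gcongr
      _ = _ := by ring
  have e : w 0 y - (F (x + h / 2) - F (x - h / 2)) / h - h * (Φ (x + h / 2) - Φ (x - h / 2))
      = (w 0 y - w 0 (d * v 1 x) - (y - d * v 1 x) * w 1 (d * v 1 x))
        + (y - d * v 1 x - h ^ 2 * d ^ 3 / 24 * v 3 x) * w 1 (d * v 1 x)
        - (F (x + h / 2) - F (x - h / 2) - 2 * (h / 2) * profile w v d x
            - (h / 2) ^ 3 / 3 * profile₂ w v d x) / h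
        - h * (Φ (x + h / 2) - Φ (x - h / 2) - 2 * (h / 2) * correction w v d x) := by
    simp only [correction, profile]
    field_simp
    ring
  rw [e]
  calc _ ≤ _ := abs_sub_le_add (abs_sub_le_add ((abs_add_le _ _).trans (add_le_add b1' b2)) b3') b4'
    _ = _ := by ring

/-- The comparison is with `bondLimit` at the actual gap `(1 - h n) / h`, which gives an error
`O(h)`; the gap is sent to its limit only in `tendsto_bondRemainder`, by continuity. -/
theorem exists_bondRemainder_expansion (P : DecayingPotential w m K β) (C : SmoothChain v m M)
    (hd : 1 ≤ d) :
    ∃ B, ∀ (h : ℝ) (n : ℕ), 0 < h → h ≤ 1 → h * n ≤ 1 → 1 < h * (n + 1) → d ≤ n →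
      |bondRemainder w v d n h - bondLimit w v ((1 - h * n) / h) d| ≤ B * h := by
  have hfc := (derivOn_profile P C hd).continuousOn
  obtain ⟨F, hF⟩ := exists_antiderivative hfc
  have hcc := (derivOn_correction P C hd).continuousOn
  obtain ⟨Φ, hΦ⟩ := exists_antiderivative hcc
  obtain ⟨B₀, hB₀⟩ := isCompact_Icc.exists_bound_of_continuousOn hcc
  have hB₀0 : 0 ≤ B₀ := (norm_nonneg _).trans (hB₀ 0 (by simp))
  obtain ⟨B, hB, hcell⟩ := exists_bond_sub_cell_expansion P C hd hF hΦ
  have cv : Convex ℝ (Icc (0 : ℝ) 1) := convex_Icc 0 1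
  have z0 : (0 : ℝ) ∈ Icc (0 : ℝ) 1 := by simp
  have z1 : (1 : ℝ) ∈ Icc (0 : ℝ) 1 := by simp
  have hM := C.one_le
  have hK := P.Kβ_nonneg d
  refine ⟨B + B₀ * d + B₀ * d + K * β d * (5 * M ^ 3) * d ^ 3
    + K * β d * (5 * M ^ 3) * d ^ 3, fun h n hh h1 hn hn' hdn => ?_⟩
  rw [bondRemainder_eq hF hfc hh hdn, bondLimit, hΦ.integral_eq hcc]
  obtain ⟨m0, m1⟩ := ends_mem hd hh hn hdn
  obtain ⟨l0, l1⟩ := ends_abs_le hd hh hn hn'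
  have c0 := abs_sum_range_le (n := n) (by positivity) (by omega : n + 1 - d ≤ n)
      (fun i hi => hcell h n i hh h1 hn (by omega : i + d ≤ n))
  rw [Finset.sum_sub_distrib, ← Finset.mul_sum, sum_cells,
    show (((n + 1 - d : ℕ) : ℝ) + (d - 1) / 2) = n - (d - 1) / 2 by
      rw [Nat.cast_sub (by omega)]; push_cast; ring] at c0
  set S := ∑ i ∈ Finset.range (n + 1 - d), (w 0 ((v 0 (h * (i + d)) - v 0 (h * i)) / h)
        - (F (h * (i + d / 2) + h / 2) - F (h * (i + d / 2) - h / 2)) / h)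
  have c0' : |(S - h * (Φ (h * (n - (d - 1) / 2)) - Φ (h * ((d - 1) / 2)))) / h| ≤ B * h := by
    rw [abs_div, abs_of_pos hh, div_le_iff₀ hh]
    calc _ ≤ _ := c0
      _ = (B * h ^ 2) * (h * n) := by ring
      _ ≤ (B * h ^ 2) * 1 := by gcongr
      _ = _ := by ring
  have c1 : |Φ (h * ((d - 1) / 2)) - Φ 0| ≤ B₀ * d * h := by
    calc _ ≤ _ := hΦ.abs_sub_le cv hB₀ z0 m0
      _ ≤ B₀ * (h * d) := by gcongr
      _ = _ := by ring
  have c2 : |Φ (h * (n - (d - 1) / 2)) - Φ 1| ≤ B₀ * d * h := by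
    calc _ ≤ _ := hΦ.abs_sub_le cv hB₀ z1 m1
      _ ≤ B₀ * (h * d) := by gcongr
      _ = _ := by ring
  have c3 := hF.taylor_two (derivOn_profile P C hd) (derivOn_profile₁ P C hd) cv
    (fun x hx => abs_profile₂_le P C hd hx) z0 m0
  have c4 := hF.taylor_two (derivOn_profile P C hd) (derivOn_profile₁ P C hd) cv
    (fun x hx => abs_profile₂_le P C hd hx) z1 m1
  have c3' : |(F (h * ((d - 1) / 2)) - F 0 - (h * ((d - 1) / 2) - 0) * profile w v d 0
      - (h * ((d - 1) / 2) - 0) ^ 2 / 2 * profile₁ w v d 0) / h ^ 2|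
      ≤ K * β d * (5 * M ^ 3) * d ^ 3 * h := by
    rw [abs_div, abs_of_pos (pow_pos hh 2), div_le_iff₀ (by positivity)]
    calc _ ≤ _ := c3
      _ ≤ K * β d * (5 * M ^ 3) * (h * d) ^ 3 := by gcongr
      _ = _ := by ring
  have c4' : |(F (h * (n - (d - 1) / 2)) - F 1 - (h * (n - (d - 1) / 2) - 1) * profile w v d 1
      - (h * (n - (d - 1) / 2) - 1) ^ 2 / 2 * profile₁ w v d 1) / h ^ 2|
      ≤ K * β d * (5 * M ^ 3) * d ^ 3 * h := by
    rw [abs_div, abs_of_pos (pow_pos hh 2), div_le_iff₀ (by positivity)]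
    calc _ ≤ _ := c4
      _ ≤ K * β d * (5 * M ^ 3) * (h * d) ^ 3 := by gcongr
      _ = _ := by ring
  calc _ = |(S - h * (Φ (h * (n - (d - 1) / 2)) - Φ (h * ((d - 1) / 2)))) / h
        - (Φ (h * ((d - 1) / 2)) - Φ 0) + (Φ (h * (n - (d - 1) / 2)) - Φ 1)
        - (F (h * ((d - 1) / 2)) - F 0 - (h * ((d - 1) / 2) - 0) * profile w v d 0
            - (h * ((d - 1) / 2) - 0) ^ 2 / 2 * profile₁ w v d 0) / h ^ 2
        + (F (h * (n - (d - 1) / 2)) - F 1 - (h * (n - (d - 1) / 2) - 1) * profile w v d 1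
            - (h * (n - (d - 1) / 2) - 1) ^ 2 / 2 * profile₁ w v d 1) / h ^ 2| := by
        congr 1; field_simp; ring
    _ ≤ _ := (abs_add_le _ _).trans (add_le_add (abs_sub_le_add ((abs_add_le _ _).trans
          (add_le_add (abs_sub_le_add c0' c1) c2)) c3') c4')
    _ = _ := by ring

theorem LatticeSeq.eventually_le {h : ℕ → ℝ} {n : ℕ → ℕ} {a : ℝ} (L : LatticeSeq h n a) (d : ℕ) :
    ∀ᶠ q in atTop, d ≤ n q := by
  have : Tendsto (fun q => h q * d) atTop (𝓝 (0 * d)) := L.lim.mul_const _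
  rw [zero_mul] at this
  filter_upwards [this.eventually (gt_mem_nhds one_pos)] with q hq
  by_contra! hlt
  have : (n q : ℝ) + 1 ≤ d := by exact_mod_cast hlt
  have := mul_le_mul_of_nonneg_left this (L.pos q).le
  have := L.lt q
  linarith

theorem tendsto_bondRemainder (P : DecayingPotential w m K β) (C : SmoothChain v m M) (hd : 1 ≤ d)
    {h : ℕ → ℝ} {n : ℕ → ℕ} {a : ℝ} (L : LatticeSeq h n a) :
    Tendsto (fun q => bondRemainder w v d (n q) (h q)) atTop (𝓝 (bondLimit w v a d)) := by
  obtain ⟨B, hB⟩ := exists_bondRemainder_expansion P C hd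
  have h1 : Tendsto (fun q => bondRemainder w v d (n q) (h q)
      - bondLimit w v ((1 - h q * n q) / h q) d) atTop (𝓝 0) := by
    have hlim : Tendsto (fun q => B * h q) atTop (𝓝 0) := by simpa using L.lim.const_mul B
    refine squeeze_zero_norm' ?_ hlim
    filter_upwards [L.le, L.eventually_le d, L.lim.eventually (ge_mem_nhds one_pos)]
      with q hq hq2 hq3
    exact hB _ _ (L.pos q) hq3 hq (L.lt q) hq2
  have h2 : Tendsto (fun q => bondLimit w v ((1 - h q * n q) / h q) d) atTop
      (𝓝 (bondLimit w v a d)) :=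
    tendsto_const_nhds.add ((((L.gap.add_const _).pow 2).div_const 2).mul_const _)
  simpa using h1.add h2

theorem DecayingPotential.summable_of_le (hβ : Summable fun d : ℕ => β d * d ^ 2) {c : ℝ}
    {g : ℕ → ℝ} (hg : ∀ d : ℕ, 1 ≤ d → |g d| ≤ c * (β d * d ^ 2)) :
    Summable fun d : ℕ => g (d + 1) := by
  have := ((summable_nat_add_iff 1).2 hβ).mul_left c
  exact .of_norm_bounded this fun d => hg (d + 1) (by omega)

/-- Dominated convergence for series, with majorant `β d * d ^ 2`. The zeroth- and first-order terms
are summed separately, which needs their own summability. -/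
theorem tendsto_chain (P : DecayingPotential w m K β) (C : SmoothChain v m M)
    (hβ : Summable fun d : ℕ => β d * d ^ 2)
    {h : ℕ → ℝ} {n : ℕ → ℕ} {a : ℝ} (L : LatticeSeq h n a) :
    Tendsto (fun q => ((∑ d ∈ Finset.range (n q), bondSum w v (d + 1) (n q) (h q))
      - (1 / h q) * (∑' d : ℕ, ∫ x in (0 : ℝ)..1, profile w v (d + 1) x)
      + (∑' d : ℕ, (d : ℝ) / 2 * (profile w v (d + 1) 0 + profile w v (d + 1) 1))
      + (1 - h q * n q) / h q * ∑' d : ℕ, profile w v (d + 1) 1) / h q) atTop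
      (𝓝 (∑' d : ℕ, bondLimit w v a (d + 1))) := by
  have z0 : (0 : ℝ) ∈ Icc (0 : ℝ) 1 := by simp
  have z1 : (1 : ℝ) ∈ Icc (0 : ℝ) 1 := by simp
  have key := tendsto_tsum_of_dominated_convergence (𝓕 := atTop)
    (f := fun q (d : ℕ) => bondRemainder w v (d + 1) (n q) (h q))
    (g := fun d => bondLimit w v a (d + 1))
    (((summable_nat_add_iff 1).2 hβ).mul_left (14 * K * M ^ 3))
    (fun d => tendsto_bondRemainder P C (by omega) L)
    (by filter_upwards [L.le] with q hq d using
          abs_bondRemainder_le P C (by omega) (L.pos q) hq (L.lt q))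
  refine key.congr fun q => ?_
  have one_le_sq : ∀ d : ℕ, 1 ≤ d → K * β d ≤ K * (β d * d ^ 2) := fun d hd => by
    have : (1 : ℝ) ≤ d ^ 2 := one_le_pow₀ (by exact_mod_cast hd)
    have := P.β_nonneg d
    have := P.K_nonneg
    gcongr
    exact le_mul_of_one_le_right ‹_› ‹_›
  have s1 : Summable fun d : ℕ => ∫ x in (0 : ℝ)..1, profile w v (d + 1) x := by
    refine DecayingPotential.summable_of_le hβ (c := K)
      (g := fun d => ∫ x in (0 : ℝ)..1, profile w v d x) fun d hd => ?_
    have := intervalIntegral.norm_integral_le_of_norm_le_const (a := 0) (b := 1) (C := K * β d)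
      (f := profile w v d) (fun x hx => by
        rw [uIoc_of_le zero_le_one] at hx
        exact abs_profile_le P C hd (Ioc_subset_Icc_self hx))
    rw [sub_zero, abs_one, mul_one] at this
    exact this.trans (one_le_sq d hd)
  have s2 : Summable fun d : ℕ =>
      (d : ℝ) / 2 * (profile w v (d + 1) 0 + profile w v (d + 1) 1) := by
    have := DecayingPotential.summable_of_le hβ (c := K)
      (g := fun d => ((d : ℝ) - 1) / 2 * (profile w v d 0 + profile w v d 1)) fun d hd => by
        have hd1 : (1 : ℝ) ≤ d := by exact_mod_cast hd
        have hK := P.Kβ_nonneg d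
        have h0 := abs_profile_le P C hd z0
        have h1 := abs_profile_le P C hd z1
        rw [abs_mul, abs_of_nonneg (by linarith)]
        calc _ ≤ (d : ℝ) / 2 * (K * β d + K * β d) := by
              refine mul_le_mul (by linarith) ((abs_add_le _ _).trans (add_le_add h0 h1))
                (abs_nonneg _) (by positivity)
          _ = K * β d * d := by ring
          _ ≤ K * β d * d ^ 2 := by gcongr; exact le_self_pow₀ hd1 (by norm_num)
          _ = _ := by ring
    simpa using this
  have s3 : Summable fun d : ℕ => profile w v (d + 1) 1 :=
    DecayingPotential.summable_of_le hβ (c := K) (g := fun d => profile w v d 1) fun d hd =>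
      (abs_profile_le P C hd z1).trans (one_le_sq d hd)
  -- Beyond `d = n` the sum over bonds is empty, so the finite sum over `d` is the whole series.
  have s0 : HasSum (fun d : ℕ => bondSum w v (d + 1) (n q) (h q))
      (∑ d ∈ Finset.range (n q), bondSum w v (d + 1) (n q) (h q)) := by
    refine hasSum_sum_of_ne_finset_zero fun d hd => ?_
    rw [Finset.mem_range, not_lt] at hd
    rw [bondSum, show n q + 1 - (d + 1) = 0 by omega, Finset.range_zero, Finset.sum_empty]
  have := (((s0.sub (s1.hasSum.mul_left (1 / h q))).add s2.hasSum).add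
    (s3.hasSum.mul_left ((1 - h q * n q) / h q))).div_const (h q)
  rw [← this.tsum_eq]
  refine tsum_congr fun d => ?_
  rw [bondRemainder]
  push_cast
  ring

end Limit

/-! ### Bonds straddling the kink. -/

/-- The strain of the bond between the `i`-th atom of the left chain `u` and the `j`-th atom of the
right chain `v`. -/
def crossArg (v u : ℕ → ℝ → ℝ) (h : ℝ) (i j : ℕ) : ℝ :=
  ((v 0 (h * j) - v 0 0) + (u 0 (h * i) - u 0 0)) / h

/-- The limiting strain of the bond in `crossArg`. -/
def crossArg₀ (v u : ℕ → ℝ → ℝ) (i j : ℕ) : ℝ := v 1 0 * j + u 1 0 * i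

/-- The energy of the bonds between the two chains. -/
def crossSum (w v u : ℕ → ℝ → ℝ) (n : ℕ) (h : ℝ) : ℝ :=
  ∑ p ∈ Finset.range n ×ˢ Finset.range n, w 0 (crossArg v u h (p.1 + 1) (p.2 + 1))

/-- The first-order term in the expansion of the energy of a bond between the two chains. -/
def crossLimit (w v u : ℕ → ℝ → ℝ) (i j : ℕ) : ℝ :=
  w 1 (crossArg₀ v u i j) * (v 2 0 * j ^ 2 / 2 + u 2 0 * i ^ 2 / 2)

section Cross

variable {w v u : ℕ → ℝ → ℝ} {m K M : ℝ} {β : ℕ → ℝ} {i j n : ℕ} {h : ℝ}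

theorem SmoothChain.half_arg (C : SmoothChain v m M) (hh : 0 < h) (hn : h * n ≤ 1) (hj : j ≤ n) :
    m * j * h ≤ v 0 (h * j) - v 0 0 ∧
    |v 0 (h * j) - v 0 0 - h * j * v 1 0| ≤ M * j ^ 2 * h ^ 2 ∧
    |v 0 (h * j) - v 0 0 - h * j * v 1 0 - h ^ 2 * j ^ 2 / 2 * v 2 0| ≤ M * j ^ 3 * h ^ 3 := by
  have cv : Convex ℝ (Icc (0 : ℝ) 1) := convex_Icc 0 1
  have z0 : (0 : ℝ) ∈ Icc (0 : ℝ) 1 := by simp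
  have hp : 0 ≤ h * j := by positivity
  have hx : h * j ∈ Icc (0 : ℝ) 1 := by
    refine ⟨hp, le_trans ?_ hn⟩
    gcongr
  refine ⟨?_, ?_, ?_⟩
  · have := (C.deriv 0).mul_sub_le cv C.lower z0 hx hp
    linarith
  · have := (C.deriv 0).taylor_one (C.deriv 1) cv (C.bound 2 (by norm_num) (by norm_num)) z0 hx
    rw [sub_zero, abs_of_nonneg hp] at this
    calc _ ≤ _ := this
      _ = _ := by ring
  · have := (C.deriv 0).taylor_two (C.deriv 1) (C.deriv 2) cv
      (C.bound 3 (by norm_num) (by norm_num)) z0 hx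
    rw [sub_zero, abs_of_nonneg hp] at this
    calc _ = _ := by congr 1; ring
      _ ≤ _ := this
      _ = _ := by ring

theorem crossArg₀_ge (C : SmoothChain v m M) (C' : SmoothChain u m M) (i j : ℕ) :
    m * (i + j : ℕ) ≤ crossArg₀ v u i j := by
  have z0 : (0 : ℝ) ∈ Icc (0 : ℝ) 1 := by simp
  have h1 := mul_le_mul_of_nonneg_right (C.lower 0 z0) j.cast_nonneg
  have h2 := mul_le_mul_of_nonneg_right (C'.lower 0 z0) i.cast_nonneg
  rw [crossArg₀]
  push_cast
  linarith

theorem crossArg_bounds (C : SmoothChain v m M) (C' : SmoothChain u m M) (hh : 0 < h)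
    (hn : h * n ≤ 1) (hi : i ≤ n) (hj : j ≤ n) :
    m * (i + j : ℕ) ≤ crossArg v u h i j ∧
    |crossArg v u h i j - crossArg₀ v u i j| ≤ M * (i + j : ℕ) ^ 2 * h ∧
    |crossArg v u h i j - crossArg₀ v u i j - h * (v 2 0 * j ^ 2 / 2 + u 2 0 * i ^ 2 / 2)|
      ≤ M * (i ^ 3 + j ^ 3) * h ^ 2 := by
  obtain ⟨a1, a2, a3⟩ := C.half_arg hh hn hj
  obtain ⟨b1, b2, b3⟩ := C'.half_arg hh hn hi
  have hM := C.one_le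
  have hi0 : (0 : ℝ) ≤ i := i.cast_nonneg
  have hj0 : (0 : ℝ) ≤ j := j.cast_nonneg
  refine ⟨?_, ?_, ?_⟩
  · rw [crossArg, le_div_iff₀ hh]; push_cast; linarith
  · have e : crossArg v u h i j - crossArg₀ v u i j
        = ((v 0 (h * j) - v 0 0 - h * j * v 1 0) + (u 0 (h * i) - u 0 0 - h * i * u 1 0)) / h := by
      rw [crossArg, crossArg₀]; field_simp; ring
    rw [e, abs_div, abs_of_pos hh, div_le_iff₀ hh]
    calc _ ≤ _ := (abs_add_le _ _).trans (add_le_add a2 b2)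
      _ = M * (j ^ 2 + i ^ 2) * h ^ 2 := by ring
      _ ≤ M * (i + j : ℕ) ^ 2 * h ^ 2 := by
        push_cast; gcongr; nlinarith [mul_nonneg hi0 hj0]
      _ = _ := by ring
  · have e : crossArg v u h i j - crossArg₀ v u i j - h * (v 2 0 * j ^ 2 / 2 + u 2 0 * i ^ 2 / 2)
        = ((v 0 (h * j) - v 0 0 - h * j * v 1 0 - h ^ 2 * j ^ 2 / 2 * v 2 0)
          + (u 0 (h * i) - u 0 0 - h * i * u 1 0 - h ^ 2 * i ^ 2 / 2 * u 2 0)) / h := by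
      rw [crossArg, crossArg₀]; field_simp; ring
    rw [e, abs_div, abs_of_pos hh, div_le_iff₀ hh]
    calc _ ≤ _ := (abs_add_le _ _).trans (add_le_add a3 b3)
      _ = _ := by ring

/-- The strain is off by at most `M (i + j)² h`, while `w 1` is at most `K β (i + j) / (i + j)`
because both strains are at least `m (i + j)`. -/
theorem abs_cross_sub_le (P : DecayingPotential w m K β) (C : SmoothChain v m M)
    (C' : SmoothChain u m M) (hh : 0 < h) (hn : h * n ≤ 1) (hi : i ≤ n) (hj : j ≤ n)
    (hi1 : 1 ≤ i) :
    |(w 0 (crossArg v u h i j) - w 0 (crossArg₀ v u i j)) / h|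
      ≤ K * M * (β (i + j) * (i + j : ℕ)) := by
  obtain ⟨h1, h2, -⟩ := crossArg_bounds C C' hh hn hi hj
  have hd : 1 ≤ i + j := by omega
  have hd1 : (1 : ℝ) ≤ (i + j : ℕ) := by exact_mod_cast hd
  have hK := P.Kβ_nonneg (i + j)
  rw [abs_div, abs_of_pos hh, div_le_iff₀ hh]
  calc _ ≤ K * β (i + j) / (i + j : ℕ) * |crossArg v u h i j - crossArg₀ v u i j| := by
        refine (P.derivOn hd 0).abs_sub_le (convex_Ici _) (fun z hz => ?_)
          (crossArg₀_ge C C' i j) h1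
        rw [le_div_iff₀ (by linarith)]
        simpa using P.bound 1 (by norm_num) _ hd z hz
    _ ≤ K * β (i + j) / (i + j : ℕ) * (M * (i + j : ℕ) ^ 2 * h) := by gcongr
    _ = _ := by field_simp

theorem tendsto_cross_term (P : DecayingPotential w m K β) (C : SmoothChain v m M)
    (C' : SmoothChain u m M) (hi1 : 1 ≤ i)
    {h : ℕ → ℝ} {n : ℕ → ℕ} {a : ℝ} (L : LatticeSeq h n a) :
    Tendsto (fun q => (w 0 (crossArg v u (h q) i j) - w 0 (crossArg₀ v u i j)) / h q) atTop
      (𝓝 (crossLimit w v u i j)) := by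
  have hd : 1 ≤ i + j := by omega
  have hK := P.Kβ_nonneg (i + j)
  have hM := C.one_le
  rw [← tendsto_sub_nhds_zero_iff]
  have hlim : Tendsto (fun q => (K * β (i + j) * (M * (i + j : ℕ) ^ 2) ^ 2
      + K * β (i + j) * (M * (i ^ 3 + j ^ 3))) * h q) atTop (𝓝 0) := by
    simpa only [mul_zero] using L.lim.const_mul _
  refine squeeze_zero_norm' ?_ hlim
  filter_upwards [L.le, L.eventually_le i, L.eventually_le j] with q hn hi hj
  have hh := L.pos q
  obtain ⟨h1, h2, h3⟩ := crossArg_bounds C C' hh hn hi hj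
  set y := crossArg v u (h q) i j
  have b1 := (P.derivOn hd 0).taylor_one (P.derivOn hd 1) (convex_Ici _)
    (fun z hz => P.abs_le (k := 2) (by norm_num) hd hz) (crossArg₀_ge C C' i j) h1
  have b1' : |(w 0 y - w 0 (crossArg₀ v u i j) - (y - crossArg₀ v u i j) * w 1 (crossArg₀ v u i j))
      / h q| ≤ K * β (i + j) * (M * (i + j : ℕ) ^ 2) ^ 2 * h q := by
    rw [abs_div, abs_of_pos hh, div_le_iff₀ hh]
    calc _ ≤ _ := b1
      _ ≤ K * β (i + j) * (M * (i + j : ℕ) ^ 2 * h q) ^ 2 := by gcongr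
      _ = _ := by ring
  have b2 : |w 1 (crossArg₀ v u i j) * ((y - crossArg₀ v u i j
      - h q * (v 2 0 * j ^ 2 / 2 + u 2 0 * i ^ 2 / 2)) / h q)|
      ≤ K * β (i + j) * (M * (i ^ 3 + j ^ 3) * h q) := by
    rw [abs_mul]
    refine mul_le_mul (P.abs_le (k := 1) (by norm_num) hd (crossArg₀_ge C C' i j)) ?_
      (abs_nonneg _) hK
    rw [abs_div, abs_of_pos hh, div_le_iff₀ hh]
    calc _ ≤ _ := h3
      _ = _ := by ring
  have e : (w 0 y - w 0 (crossArg₀ v u i j)) / h q - crossLimit w v u i j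
      = (w 0 y - w 0 (crossArg₀ v u i j) - (y - crossArg₀ v u i j) * w 1 (crossArg₀ v u i j)) / h q
        + w 1 (crossArg₀ v u i j) * ((y - crossArg₀ v u i j
          - h q * (v 2 0 * j ^ 2 / 2 + u 2 0 * i ^ 2 / 2)) / h q) := by
    rw [crossLimit]; field_simp; ring
  rw [e]
  calc _ ≤ _ := (abs_add_le _ _).trans (add_le_add b1' b2)
    _ = _ := by ring

theorem summable_crossArg₀ (P : DecayingPotential w m K β) (C : SmoothChain v m M)
    (C' : SmoothChain u m M)
    (hβ : Summable fun p : ℕ × ℕ => β (p.1 + 1 + (p.2 + 1)) * (p.1 + 1 + (p.2 + 1) : ℕ)) :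
    Summable fun p : ℕ × ℕ => w 0 (crossArg₀ v u (p.1 + 1) (p.2 + 1)) := by
  refine .of_norm_bounded (hβ.mul_left K) fun p => ?_
  have hd : 1 ≤ p.1 + 1 + (p.2 + 1) := by omega
  refine (P.abs_le (k := 0) (by norm_num) hd (crossArg₀_ge C C' _ _)).trans ?_
  rw [← mul_assoc]
  exact le_mul_of_one_le_right (P.Kβ_nonneg _) (by exact_mod_cast hd)

theorem summable_crossLimit (P : DecayingPotential w m K β) (C : SmoothChain v m M)
    (C' : SmoothChain u m M)
    (hβ : Summable fun p : ℕ × ℕ => β (p.1 + 1 + (p.2 + 1)) * (p.1 + 1 + (p.2 + 1) : ℕ)) :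
    Summable fun p : ℕ × ℕ => crossLimit w v u (p.1 + 1) (p.2 + 1) := by
  refine .of_norm_bounded (hβ.mul_left (K * M)) fun p => ?_
  have hd : 1 ≤ p.1 + 1 + (p.2 + 1) := by omega
  have z0 : (0 : ℝ) ∈ Icc (0 : ℝ) 1 := by simp
  have b := P.bound 1 (by norm_num) _ hd _ (crossArg₀_ge C C' (p.1 + 1) (p.2 + 1))
  have c1 := C.bound 2 le_rfl (by norm_num) 0 z0
  have c2 := C'.bound 2 le_rfl (by norm_num) 0 z0
  have hM := C.one_le
  have hi0 : (0 : ℝ) ≤ (p.1 + 1 : ℕ) := Nat.cast_nonneg _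
  have hj0 : (0 : ℝ) ≤ (p.2 + 1 : ℕ) := Nat.cast_nonneg _
  rw [crossLimit, Real.norm_eq_abs, abs_mul]
  set i : ℕ := p.1 + 1
  set j : ℕ := p.2 + 1
  have c3 : |v 2 0 * j ^ 2 / 2 + u 2 0 * i ^ 2 / 2| ≤ M * (i + j : ℕ) ^ 2 := by
    calc _ ≤ |v 2 0| * j ^ 2 / 2 + |u 2 0| * i ^ 2 / 2 := by
          refine (abs_add_le _ _).trans (le_of_eq ?_)
          simp only [abs_mul, abs_div, abs_pow, Nat.abs_cast, Nat.abs_ofNat]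
      _ ≤ M * j ^ 2 / 2 + M * i ^ 2 / 2 := by gcongr
      _ = M * ((i : ℝ) ^ 2 / 2 + j ^ 2 / 2) := by ring
      _ ≤ M * (i + j : ℕ) ^ 2 := by
        push_cast
        gcongr
        nlinarith [mul_nonneg hi0 hj0]
  calc _ ≤ |w 1 (crossArg₀ v u i j)| * (M * (i + j : ℕ) ^ 2) := by gcongr
    _ = |w 1 (crossArg₀ v u i j)| * (i + j : ℕ) ^ 1 * (M * (i + j : ℕ)) := by ring
    _ ≤ K * β (i + j) * (M * (i + j : ℕ)) := by gcongr
    _ = _ := by ring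

/-- Dominated convergence over pairs, the finite square being extended by zero to all of `ℕ × ℕ`. -/
theorem tendsto_cross (P : DecayingPotential w m K β) (C : SmoothChain v m M)
    (C' : SmoothChain u m M)
    (hβ : Summable fun p : ℕ × ℕ => β (p.1 + 1 + (p.2 + 1)) * (p.1 + 1 + (p.2 + 1) : ℕ))
    {h : ℕ → ℝ} {n : ℕ → ℕ} {a : ℝ} (L : LatticeSeq h n a) :
    Tendsto (fun q => (crossSum w v u (n q) (h q)
      - ∑' p : ℕ × ℕ, w 0 (crossArg₀ v u (p.1 + 1) (p.2 + 1))) / h q) atTop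
      (𝓝 (∑' p : ℕ × ℕ, crossLimit w v u (p.1 + 1) (p.2 + 1))) := by
  have hM := C.one_le
  have key := tendsto_tsum_of_dominated_convergence (𝓕 := atTop)
    (f := fun q (p : ℕ × ℕ) =>
      ((if p ∈ Finset.range (n q) ×ˢ Finset.range (n q) then
        w 0 (crossArg v u (h q) (p.1 + 1) (p.2 + 1)) else 0)
        - w 0 (crossArg₀ v u (p.1 + 1) (p.2 + 1))) / h q)
    (g := fun p => crossLimit w v u (p.1 + 1) (p.2 + 1)) (hβ.mul_left (K * M)) ?_ ?_
  · refine key.congr fun q => ?_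
    have s0 : HasSum (fun p : ℕ × ℕ => if p ∈ Finset.range (n q) ×ˢ Finset.range (n q) then
        w 0 (crossArg v u (h q) (p.1 + 1) (p.2 + 1)) else 0) (crossSum w v u (n q) (h q)) := by
      rw [crossSum, ← Finset.sum_congr rfl fun p hp => if_pos hp]
      exact hasSum_sum_of_ne_finset_zero fun p hp => if_neg hp
    exact ((s0.sub (summable_crossArg₀ P C C' hβ).hasSum).div_const (h q)).tsum_eq
  · intro p
    refine (tendsto_cross_term P C C' (i := p.1 + 1) (j := p.2 + 1) (by omega) L).congr' ?_
    filter_upwards [L.eventually_le (p.1 + 1), L.eventually_le (p.2 + 1)] with q h1 h2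
    rw [if_pos]
    rw [Finset.mem_product, Finset.mem_range, Finset.mem_range]
    omega
  · filter_upwards [L.le] with q hn p
    have hh := L.pos q
    split_ifs with hp
    · rw [Finset.mem_product, Finset.mem_range, Finset.mem_range] at hp
      exact abs_cross_sub_le P C C' hh hn (by omega) (by omega) (by omega)
    -- Outside the square one index exceeds `n`, hence `(i + j) h ≥ 1`. This pays for the division
    -- by `h` in the missing term.
    · rw [Finset.mem_product, Finset.mem_range, Finset.mem_range] at hp
      have hd : 1 ≤ p.1 + 1 + (p.2 + 1) := by omega
      have hs : (n q : ℝ) + 1 ≤ (p.1 + 1 + (p.2 + 1) : ℕ) := by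
        exact_mod_cast (by omega : n q + 1 ≤ p.1 + 1 + (p.2 + 1))
      have hs1 : 1 ≤ ((p.1 + 1 + (p.2 + 1) : ℕ) : ℝ) * h q := by
        nlinarith [L.lt q]
      have hK := P.Kβ_nonneg (p.1 + 1 + (p.2 + 1))
      rw [zero_sub, Real.norm_eq_abs, abs_div, abs_of_pos hh, abs_neg, div_le_iff₀ hh]
      calc _ ≤ K * β (p.1 + 1 + (p.2 + 1)) :=
            P.abs_le (k := 0) (by norm_num) hd (crossArg₀_ge C C' _ _)
        _ = 1 * (K * β (p.1 + 1 + (p.2 + 1))) * 1 := by ring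
        _ ≤ M * (K * β (p.1 + 1 + (p.2 + 1))) * (((p.1 + 1 + (p.2 + 1) : ℕ) : ℝ) * h q) := by
          gcongr
        _ = _ := by ring

end Cross

/-! ### Decay of the potential along the strains. -/

section Potential

variable {W : ℝ → ℝ} {α R m : ℝ}

theorem hasDerivAt_iteratedDeriv (hW : ContDiffOn ℝ ∞ W {0}ᶜ) (k : ℕ) {y : ℝ} (hy : 0 < y) :
    HasDerivAt (iteratedDeriv k W) (iteratedDeriv (k + 1) W y) y := by
  have ho : IsOpen ({0}ᶜ : Set ℝ) := isOpen_compl_singleton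
  have hd : DifferentiableOn ℝ (iteratedDerivWithin k W {0}ᶜ) {0}ᶜ :=
    hW.differentiableOn_iteratedDerivWithin (by exact_mod_cast ENat.natCast_lt_top k) ho.uniqueDiffOn
  have hd' : DifferentiableOn ℝ (iteratedDeriv k W) {0}ᶜ :=
    hd.congr fun x hx => (iteratedDerivWithin_of_isOpen ho hx).symm
  rw [iteratedDeriv_succ]
  exact ((hd' y hy.ne').differentiableAt (ho.mem_nhds hy.ne')).hasDerivAt

/-- Beyond `R` this is the decay hypothesis; on the compact interval `[m, R]`, away from the
singularity at `0`, continuity suffices. -/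
theorem exists_rpow_bound (hW : ContDiffOn ℝ ∞ W {0}ᶜ) (hm : 0 < m) (k : ℕ)
    (hdec : ∃ C : ℝ, 0 < C ∧
      ∀ x : ℝ, x ∉ Ioo (-R) R → |iteratedDeriv k W x| ≤ C * |x| ^ (-α - k)) :
    ∃ C : ℝ, 0 ≤ C ∧ ∀ y, m ≤ y → |iteratedDeriv k W y| ≤ C * y ^ (-α - k) := by
  obtain ⟨C, hC, hb⟩ := hdec
  have hcont : ContinuousOn (fun y => iteratedDeriv k W y / y ^ (-α - k)) (Icc m R) := by
    intro y hy
    have hy0 : 0 < y := hm.trans_le hy.1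
    exact ((hasDerivAt_iteratedDeriv hW k hy0).continuousAt.div
      (Real.continuousAt_rpow_const y _ (Or.inl hy0.ne'))
      (Real.rpow_pos_of_pos hy0 _).ne').continuousWithinAt
  obtain ⟨B, hB⟩ := isCompact_Icc.exists_bound_of_continuousOn hcont
  refine ⟨max C B, hC.le.trans (le_max_left _ _), fun y hy => ?_⟩
  have hy0 : 0 < y := hm.trans_le hy
  have hp := Real.rpow_pos_of_pos hy0 (-α - k)
  by_cases hyR : y ≤ R
  · have := hB y ⟨hy, hyR⟩
    rw [norm_div, Real.norm_eq_abs, Real.norm_eq_abs, abs_of_pos hp, div_le_iff₀ hp] at this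
    exact this.trans (mul_le_mul_of_nonneg_right (le_max_right _ _) hp.le)
  · have := hb y fun h => hyR h.2.le
    rw [abs_of_pos hy0] at this
    exact this.trans (mul_le_mul_of_nonneg_right (le_max_left _ _) hp.le)

/-- For `y ≥ m d` the power `y ^ (-α - k)` is at most `(m d) ^ (-α - k)`, and the factor `d ^ k`
leaves `d ^ (-α)`. Adding the constants for `k ≤ 3` gives a common `K`. -/
theorem exists_decayingPotential (hW : ContDiffOn ℝ ∞ W {0}ᶜ) (hα : 3 < α)
    (hdec : ∀ i : ℕ, ∃ C : ℝ, 0 < C ∧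
      ∀ x : ℝ, x ∉ Ioo (-R) R → |iteratedDeriv i W x| ≤ C * |x| ^ (-α - i)) (hm : 0 < m) :
    ∃ K, DecayingPotential (fun k => iteratedDeriv k W) m K (fun d => (d : ℝ) ^ (-α)) := by
  choose C hC hb using fun k => exists_rpow_bound (α := α) hW hm k (hdec k)
  have hC' : ∀ k, 0 ≤ C k * m ^ (-α - k) := fun k => mul_nonneg (hC k) (Real.rpow_nonneg hm.le _)
  refine ⟨∑ k ∈ Finset.range 4, C k * m ^ (-α - k), hm, Finset.sum_nonneg fun k _ => hC' k,
    fun d => Real.rpow_nonneg d.cast_nonneg _, fun k y hy => hasDerivAt_iteratedDeriv hW k hy,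
    fun k hk d hd y hy => ?_⟩
  have hd1 : (1 : ℝ) ≤ d := by exact_mod_cast hd
  have hd0 : (0 : ℝ) < d := by linarith
  have hmd : m ≤ m * d := le_mul_of_one_le_right hm.le hd1
  have hle : C k * m ^ (-α - k) ≤ ∑ k ∈ Finset.range 4, C k * m ^ (-α - k) :=
    Finset.single_le_sum (f := fun k : ℕ => C k * m ^ (-α - k)) (fun k _ => hC' k)
      (Finset.mem_range.2 (by omega))
  calc |iteratedDeriv k W y| * d ^ k ≤ C k * y ^ (-α - k) * d ^ k := by
        gcongr; exact hb k y (hmd.trans hy)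
    _ ≤ C k * (m * d) ^ (-α - k) * d ^ k := by
        have hk0 : (0 : ℝ) ≤ k := k.cast_nonneg
        exact mul_le_mul_of_nonneg_right (mul_le_mul_of_nonneg_left
          (Real.rpow_le_rpow_of_nonpos (mul_pos hm hd0) hy (by linarith)) (hC k)) (by positivity)
    _ = C k * m ^ (-α - k) * ((d : ℝ) ^ (-α - k) * d ^ (k : ℝ)) := by
        rw [Real.mul_rpow hm.le hd0.le, Real.rpow_natCast]; ring
    _ = C k * m ^ (-α - k) * d ^ (-α) := by
        rw [← Real.rpow_add hd0]; congr 2; ring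
    _ ≤ _ := by gcongr

theorem summable_rpow_mul_sq (hα : 3 < α) : Summable fun d : ℕ => (d : ℝ) ^ (-α) * d ^ 2 := by
  refine (Real.summable_nat_rpow.2 (by linarith : -α + 2 < -1)).congr fun d => ?_
  rcases Nat.eq_zero_or_pos d with rfl | hd
  · rw [Nat.cast_zero, Real.zero_rpow (by linarith), Real.zero_rpow (by linarith), zero_mul]
  · rw [← Real.rpow_natCast, ← Real.rpow_add (by exact_mod_cast hd)]
    norm_num

/-- As `i + j` is at least `i` and at least `j`, `(i + j) ^ (1 - α) ≤ i ^ ((1 - α) / 2) * j ^ ((1 -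
α) / 2)`. Each factor is summable precisely because `α > 3`. -/
theorem summable_rpow_add (hα : 3 < α) : Summable fun p : ℕ × ℕ =>
    ((p.1 + 1 + (p.2 + 1) : ℕ) : ℝ) ^ (-α) * ((p.1 + 1 + (p.2 + 1) : ℕ) : ℝ) := by
  have h1 : Summable fun d : ℕ => ((d + 1 : ℕ) : ℝ) ^ ((1 - α) / 2) :=
    (summable_nat_add_iff 1).2 (Real.summable_nat_rpow.2 (by linarith : (1 - α) / 2 < -1))
  refine .of_nonneg_of_le (fun p => by positivity) (fun p => ?_)
    (h1.mul_of_nonneg h1 (fun d => by positivity) (fun d => by positivity))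
  have hs : (0 : ℝ) < (p.1 + 1 + (p.2 + 1) : ℕ) := by positivity
  calc ((p.1 + 1 + (p.2 + 1) : ℕ) : ℝ) ^ (-α) * ((p.1 + 1 + (p.2 + 1) : ℕ) : ℝ)
      = ((p.1 + 1 + (p.2 + 1) : ℕ) : ℝ) ^ ((1 - α) / 2)
        * ((p.1 + 1 + (p.2 + 1) : ℕ) : ℝ) ^ ((1 - α) / 2) := by
        rw [← Real.rpow_add hs, ← Real.rpow_add_one hs.ne']; congr 1; ring
    _ ≤ _ := by
        gcongr ?_ * ?_
        · exact Real.rpow_le_rpow_of_nonpos (by positivity) (by exact_mod_cast (by omega))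
            (by linarith)
        · exact Real.rpow_le_rpow_of_nonpos (by positivity) (by exact_mod_cast (by omega))
            (by linarith)

end Potential

/-! ### The two halves of the deformation as chains on the unit interval. -/

section Deformation

variable {u : ℝ → ℝ} {a b : ℝ}

theorem IsSmoothDiffeoOn.derivOn (hu : IsSmoothDiffeoOn u (Icc a b)) (hab : a < b) (k : ℕ) :
    DerivOn (iteratedDerivWithin k u (Icc a b)) (iteratedDerivWithin (k + 1) u (Icc a b))
      (Icc a b) := by
  intro x hx
  rw [iteratedDerivWithin_succ]
  exact (hu.1.differentiableOn_iteratedDerivWithin (by exact_mod_cast ENat.natCast_lt_top k)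
    (uniqueDiffOn_Icc hab) x hx).hasDerivWithinAt

/-- Differentiating `g ∘ u = id` within the interval gives `g' u' = 1`, also at the ends, where
derivatives within `[a, b]` are still unique. With monotonicity and compactness this gives the
positive lower bound `m` of the strain per neighbour. -/
theorem IsSmoothDiffeoOn.derivWithin_ne_zero (hu : IsSmoothDiffeoOn u (Icc a b)) (hab : a < b)
    {x : ℝ} (hx : x ∈ Icc a b) : derivWithin u (Icc a b) x ≠ 0 := by
  obtain ⟨hu, g, hg, hgu⟩ := hu
  have h1 := (hu.differentiableOn (by simp) x hx).hasDerivWithinAt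
  have h2 := (hg.differentiableOn (by simp) (u x) (mem_image_of_mem u hx)).hasDerivWithinAt
  have h3 := (h2.comp x h1 (mapsTo_image u _)).congr (f₁ := id) (fun y hy => (hgu hy).symm)
    (hgu hx).symm
  have h4 := (uniqueDiffOn_Icc hab x hx).eq_deriv _ h3 (hasDerivWithinAt_id x _)
  intro h0
  rw [h0, mul_zero] at h4
  exact zero_ne_one h4

theorem IsSmoothDiffeoOn.exists_bounds (hu : IsSmoothDiffeoOn u (Icc a b)) (hab : a < b)
    (hmono : MonotoneOn u (Icc a b)) :
    ∃ m M : ℝ, 0 < m ∧ 1 ≤ M ∧ (∀ x ∈ Icc a b, m ≤ iteratedDerivWithin 1 u (Icc a b) x) ∧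
      ∀ k ≤ 4, ∀ x ∈ Icc a b, |iteratedDerivWithin k u (Icc a b) x| ≤ M := by
  have hc := fun k => (hu.derivOn hab k).continuousOn
  obtain ⟨x₀, hx₀, hmin⟩ := isCompact_Icc.exists_isMinOn (nonempty_Icc.2 hab.le) (hc 1)
  choose B hB using fun k => isCompact_Icc.exists_bound_of_continuousOn (hc k)
  have hB0 : ∀ k, 0 ≤ B k := fun k => (norm_nonneg _).trans (hB k a (left_mem_Icc.2 hab.le))
  refine ⟨_, 1 + ∑ k ∈ Finset.range 5, B k, ?_, ?_, fun x hx => hmin hx, fun k hk x hx => ?_⟩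
  · rw [iteratedDerivWithin_one]
    exact lt_of_le_of_ne hmono.derivWithin_nonneg (hu.derivWithin_ne_zero hab hx₀).symm
  · linarith [Finset.sum_nonneg fun k (_ : k ∈ Finset.range 5) => hB0 k]
  · have := Finset.single_le_sum (fun k _ => hB0 k) (Finset.mem_range.2 (by omega : k < 5))
    linarith [hB k x hx, Real.norm_eq_abs (iteratedDerivWithin k u (Icc a b) x)]

/-- The derivatives of `u` on `[0, 1]`. -/
def rightChain (u : ℝ → ℝ) (k : ℕ) (x : ℝ) : ℝ := iteratedDerivWithin k u (Icc 0 1) x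

/-- The derivatives of the reflection `x ↦ -u (-x)`, `x ∈ [0, 1]`, of `u` on `[-1, 0]`. -/
def leftChain (u : ℝ → ℝ) (k : ℕ) (x : ℝ) : ℝ :=
  (-1) ^ (k + 1) * iteratedDerivWithin k u (Icc (-1) 0) (-x)

theorem exists_smoothChain (hu_mono : MonotoneOn u (Icc (-1) 1))
    (hl : IsSmoothDiffeoOn u (Icc (-1) 0)) (hr : IsSmoothDiffeoOn u (Icc 0 1)) :
    ∃ m M, 0 < m ∧ SmoothChain (rightChain u) m M ∧ SmoothChain (leftChain u) m M := by
  obtain ⟨m₁, M₁, hm₁, hM₁, h1, h2⟩ := hr.exists_bounds zero_lt_one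
    (hu_mono.mono (Icc_subset_Icc_left (by norm_num)))
  obtain ⟨m₂, M₂, hm₂, hM₂, h3, h4⟩ := hl.exists_bounds (by norm_num)
    (hu_mono.mono (Icc_subset_Icc_right (by norm_num)))
  have hneg : MapsTo (fun x : ℝ => -x) (Icc 0 1) (Icc (-1) 0) := fun x hx =>
    ⟨neg_le_neg hx.2, neg_nonpos.2 hx.1⟩
  refine ⟨min m₁ m₂, max M₁ M₂, lt_min hm₁ hm₂, ⟨fun k => hr.derivOn zero_lt_one k,
    fun x hx => (min_le_left _ _).trans (h1 x hx),
    fun k _ hk x hx => (h2 k hk x hx).trans (le_max_left _ _), hM₁.trans (le_max_left _ _)⟩,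
    ⟨fun k x hx => ?_, fun x hx => (min_le_right _ _).trans ?_, fun k _ hk x hx =>
      le_trans ?_ (le_max_right _ _), hM₁.trans (le_max_left _ _)⟩⟩
  · have := ((hl.derivOn (by norm_num) k (-x) (hneg hx)).comp x
      (hasDerivAt_neg x).hasDerivWithinAt hneg).const_mul ((-1 : ℝ) ^ (k + 1))
    refine this.congr_deriv ?_
    rw [leftChain, pow_succ (-1 : ℝ) (k + 1)]
    ring
  · simpa [leftChain] using h3 (-x) (hneg hx)
  · rw [leftChain, abs_mul, abs_pow, abs_neg, abs_one, one_pow, one_mul]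
    exact h4 k hk (-x) (hneg hx)

theorem iteratedDeriv_eq_rightChain (hr : IsSmoothDiffeoOn u (Icc 0 1)) (k : ℕ) {x : ℝ}
    (hx : x ∈ Ioo (0 : ℝ) 1) : iteratedDeriv k u x = rightChain u k x :=
  (iteratedDerivWithin_eq_iteratedDeriv (uniqueDiffOn_Icc zero_lt_one)
    ((hr.1.contDiffAt (Icc_mem_nhds hx.1 hx.2)).of_le (by exact_mod_cast le_top))
    (Ioo_subset_Icc_self hx)).symm

theorem iteratedDeriv_neg_eq_leftChain (hl : IsSmoothDiffeoOn u (Icc (-1) 0)) (k : ℕ) {x : ℝ}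
    (hx : x ∈ Ioo (0 : ℝ) 1) : iteratedDeriv k u (-x) = (-1) ^ (k + 1) * leftChain u k x := by
  have hx' : -x ∈ Ioo (-1 : ℝ) 0 := ⟨neg_lt_neg hx.2, neg_neg_of_pos hx.1⟩
  rw [leftChain, ← mul_assoc, ← pow_add, ← two_mul, pow_mul, neg_one_sq, one_pow, one_mul]
  exact (iteratedDerivWithin_eq_iteratedDeriv (uniqueDiffOn_Icc (by norm_num))
    ((hl.1.contDiffAt (Icc_mem_nhds hx'.1 hx'.2)).of_le (by exact_mod_cast le_top))
    (Ioo_subset_Icc_self hx')).symm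

end Deformation

/-! ### Interchange of series and integral. -/

section Series

/-- Uniform domination by `b` makes the sum continuous and permits termwise integration. `G` is
prescribed only on the open interval because `deriv u` need not be the one-sided derivative at `0`
and `±1`; null sets do not matter. -/
theorem integral_series {g : ℕ → ℝ → ℝ} {b : ℕ → ℝ} {G : ℝ → ℝ}
    (hg : ∀ d, ContinuousOn (g d) (Icc 0 1)) (hb : Summable b)
    (hgb : ∀ d, ∀ x ∈ Icc (0 : ℝ) 1, |g d x| ≤ b d)
    (hG : ∀ x ∈ Ioo (0 : ℝ) 1, G x = ∑' d, g d x) :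
    IntervalIntegrable G volume 0 1 ∧
      ∫ x in (0 : ℝ)..1, G x = ∑' d, ∫ x in (0 : ℝ)..1, g d x := by
  have hI : uIoc (0 : ℝ) 1 ⊆ Icc 0 1 := by
    rw [uIoc_of_le zero_le_one]; exact Ioc_subset_Icc_self
  have hc : ContinuousOn (fun x => ∑' d, g d x) (Icc 0 1) := continuousOn_tsum hg hb hgb
  have hint : IntervalIntegrable (fun x => ∑' d, g d x) volume 0 1 :=
    (hc.mono (by rw [uIcc_of_le zero_le_one])).intervalIntegrable
  have hsum := intervalIntegral.hasSum_integral_of_dominated_convergence (μ := volume) (a := 0)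
    (b := 1) (F := g) (f := fun x => ∑' d, g d x) (fun d _ => b d)
    (fun d => ((hg d).mono hI).aestronglyMeasurable measurableSet_uIoc)
    (fun d => .of_forall fun x hx => hgb d x (hI hx))
    (.of_forall fun _ _ => hb) intervalIntegrable_const
    (.of_forall fun x hx => (Summable.of_norm_bounded hb fun d => hgb d x (hI hx)).hasSum)
  rw [hsum.tsum_eq]
  constructor
  · refine hint.congr_uIoo fun x hx => ?_
    rw [uIoo_of_le zero_le_one] at hx
    exact (hG x hx).symm
  · refine intervalIntegral.integral_congr_uIoo fun x hx => ?_
    rw [uIoo_of_le zero_le_one] at hx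
    exact hG x hx

end Series

/-! ### Splitting the energy into two chains and the straddling bonds. -/

section Pairs

/-- The sum over ordered pairs of distinct integers in `[-n, n]` of a symmetric function, split into
the pairs of nonnegative integers, the pairs of nonpositive integers, and the pairs of integers of
opposite signs. -/
theorem sum_offDiag_Icc (n : ℕ) (g : ℤ → ℤ → ℝ)
    (hg : ∀ i ∈ Finset.Icc (-n : ℤ) n, ∀ j ∈ Finset.Icc (-n : ℤ) n, i < j → g j i = g i j) :
    ∑ p ∈ (Finset.Icc (-n : ℤ) n).offDiag, g p.1 p.2 =
      2 * ((∑ d ∈ Finset.range n, ∑ i ∈ Finset.range (n - d), g i (i + (d + 1)))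
        + (∑ d ∈ Finset.range n, ∑ i ∈ Finset.range (n - d), g (-(i + (d + 1))) (-i))
        + ∑ p ∈ Finset.range n ×ˢ Finset.range n, g (-(p.1 + 1)) (p.2 + 1)) := by
  set I := Finset.Icc (-n : ℤ) n
  have hI : ∀ i, i ∈ I ↔ -n ≤ i ∧ i ≤ n := fun i => Finset.mem_Icc
  -- Swapping the two sites reduces to `i < j`. The three blocks are then reindexed, with `d + 1`
  -- the neighbour distance inside a chain.
  have h1 : ∑ p ∈ I.offDiag with ¬ p.1 < p.2, g p.1 p.2
      = ∑ p ∈ I.offDiag with p.1 < p.2, g p.1 p.2 := by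
    refine Finset.sum_nbij' Prod.swap Prod.swap ?_ ?_ ?_ ?_ ?_
    · rintro ⟨i, j⟩ h
      simp only [Finset.mem_filter, Finset.mem_offDiag, Prod.swap] at h ⊢
      exact ⟨⟨h.1.2.1, h.1.1, h.1.2.2.symm⟩, by omega⟩
    · rintro ⟨i, j⟩ h
      simp only [Finset.mem_filter, Finset.mem_offDiag, Prod.swap] at h ⊢
      exact ⟨⟨h.1.2.1, h.1.1, h.1.2.2.symm⟩, by omega⟩
    · simp
    · simp
    · rintro ⟨i, j⟩ h
      simp only [Finset.mem_filter, Finset.mem_offDiag, Prod.swap] at h ⊢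
      exact hg j h.1.2.1 i h.1.1 (by omega)
  have h2 : ∑ p ∈ (I.offDiag.filter fun p => p.1 < p.2) with 0 ≤ p.1, g p.1 p.2
      = ∑ d ∈ Finset.range n, ∑ i ∈ Finset.range (n - d), g i (i + (d + 1)) := by
    rw [Finset.sum_sigma']
    refine Finset.sum_nbij' (fun p => ⟨(p.2 - p.1 - 1).toNat, p.1.toNat⟩)
      (fun q => ((q.2 : ℤ), (q.2 : ℤ) + (q.1 + 1))) ?_ ?_ ?_ ?_ ?_
    · rintro ⟨i, j⟩ h
      simp only [Finset.mem_filter, Finset.mem_offDiag, hI, Finset.mem_sigma,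
        Finset.mem_range] at h ⊢
      omega
    · rintro ⟨d, i⟩ h
      simp only [Finset.mem_filter, Finset.mem_offDiag, hI, Finset.mem_sigma,
        Finset.mem_range] at h ⊢
      omega
    · rintro ⟨i, j⟩ h
      simp only [Finset.mem_filter, Finset.mem_offDiag, hI, Prod.mk.injEq] at h ⊢
      omega
    · rintro ⟨d, i⟩ h
      simp only [Sigma.mk.injEq, heq_eq_eq]
      omega
    · rintro ⟨i, j⟩ h
      simp only [Finset.mem_filter, Finset.mem_offDiag, hI] at h ⊢
      congr 1 <;> omega
  have h3 : ∑ p ∈ ((I.offDiag.filter fun p => p.1 < p.2).filter fun p => ¬ 0 ≤ p.1) with p.2 ≤ 0,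
        g p.1 p.2
      = ∑ d ∈ Finset.range n, ∑ i ∈ Finset.range (n - d), g (-(i + (d + 1))) (-i) := by
    rw [Finset.sum_sigma']
    refine Finset.sum_nbij' (fun p => ⟨(p.2 - p.1 - 1).toNat, (-p.2).toNat⟩)
      (fun q => (-((q.2 : ℤ) + (q.1 + 1)), -(q.2 : ℤ))) ?_ ?_ ?_ ?_ ?_
    · rintro ⟨i, j⟩ h
      simp only [Finset.mem_filter, Finset.mem_offDiag, hI, Finset.mem_sigma,
        Finset.mem_range] at h ⊢
      omega
    · rintro ⟨d, i⟩ h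
      simp only [Finset.mem_filter, Finset.mem_offDiag, hI, Finset.mem_sigma,
        Finset.mem_range] at h ⊢
      omega
    · rintro ⟨i, j⟩ h
      simp only [Finset.mem_filter, Finset.mem_offDiag, hI, Prod.mk.injEq] at h ⊢
      omega
    · rintro ⟨d, i⟩ h
      simp only [Sigma.mk.injEq, heq_eq_eq]
      omega
    · rintro ⟨i, j⟩ h
      simp only [Finset.mem_filter, Finset.mem_offDiag, hI] at h ⊢
      congr 1 <;> omega
  have h4 : ∑ p ∈ ((I.offDiag.filter fun p => p.1 < p.2).filter fun p => ¬ 0 ≤ p.1)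
        with ¬ p.2 ≤ 0, g p.1 p.2
      = ∑ p ∈ Finset.range n ×ˢ Finset.range n, g (-(p.1 + 1)) (p.2 + 1) := by
    refine Finset.sum_nbij' (fun p => ((-p.1 - 1).toNat, (p.2 - 1).toNat))
      (fun q => (-((q.1 : ℤ) + 1), (q.2 : ℤ) + 1)) ?_ ?_ ?_ ?_ ?_
    · rintro ⟨i, j⟩ h
      simp only [Finset.mem_filter, Finset.mem_offDiag, hI, Finset.mem_product,
        Finset.mem_range] at h ⊢
      omega
    · rintro ⟨i, j⟩ h
      simp only [Finset.mem_filter, Finset.mem_offDiag, hI, Finset.mem_product,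
        Finset.mem_range] at h ⊢
      omega
    · rintro ⟨i, j⟩ h
      simp only [Finset.mem_filter, Finset.mem_offDiag, hI, Prod.mk.injEq] at h ⊢
      omega
    · rintro ⟨i, j⟩ h
      simp only [Prod.mk.injEq]
      omega
    · rintro ⟨i, j⟩ h
      simp only [Finset.mem_filter, Finset.mem_offDiag, hI] at h ⊢
      congr 1 <;> omega
  rw [← Finset.sum_filter_add_sum_filter_not I.offDiag (fun p => p.1 < p.2), h1,
    ← Finset.sum_filter_add_sum_filter_not (I.offDiag.filter fun p => p.1 < p.2)
      (fun p => 0 ≤ p.1),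
    ← Finset.sum_filter_add_sum_filter_not
      ((I.offDiag.filter fun p => p.1 < p.2).filter fun p => ¬ 0 ≤ p.1) (fun p => p.2 ≤ 0),
    h2, h3, h4]
  ring

theorem IsSmoothDiffeoOn.injOn {u : ℝ → ℝ} {s : Set ℝ} (hu : IsSmoothDiffeoOn u s) :
    InjOn u s :=
  let ⟨_, _, _, hg⟩ := hu
  hg.injOn

theorem strictMonoOn_of_halves {u : ℝ → ℝ} (hu_mono : MonotoneOn u (Icc (-1) 1))
    (hl : IsSmoothDiffeoOn u (Icc (-1) 0)) (hr : IsSmoothDiffeoOn u (Icc 0 1)) :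
    StrictMonoOn u (Icc (-1) 1) := by
  have h1 : StrictMonoOn u (Icc (-1) 0) :=
    (hu_mono.mono (Icc_subset_Icc_right (by norm_num))).strictMonoOn_of_injOn hl.injOn
  have h2 : StrictMonoOn u (Icc 0 1) :=
    (hu_mono.mono (Icc_subset_Icc_left (by norm_num))).strictMonoOn_of_injOn hr.injOn
  have := h1.union h2 (isGreatest_Icc (by norm_num)) (isLeast_Icc (by norm_num))
  rwa [Icc_union_Icc_eq_Icc (by norm_num) (by norm_num)] at this

theorem k₂_eq {h : ℝ} (hh : 0 < h) : k₂ 1 0 h = (⌊1 / h⌋₊ : ℤ) := by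
  rw [k₂, sub_zero, Int.natCast_floor_eq_floor (by positivity)]

theorem k₁_eq {h : ℝ} (hh : 0 < h) : k₁ (-1) 0 h = -(⌊1 / h⌋₊ : ℤ) := by
  rw [k₁, sub_zero, Int.natCast_floor_eq_floor (by positivity), neg_div, Int.ceil_neg]

theorem energy_eq {W u : ℝ → ℝ} (hW_even : ∀ x : ℝ, x ≠ 0 → W x = W (-x))
    (hu : StrictMonoOn u (Icc (-1) 1)) {h : ℝ} (hh : 0 < h) :
    energy W u (-1) 1 0 h = 1 / (2 * ⌊1 / h⌋₊ + 1) *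
      ((∑ d ∈ Finset.range ⌊1 / h⌋₊,
          bondSum (fun k => iteratedDeriv k W) (rightChain u) (d + 1) ⌊1 / h⌋₊ h)
        + (∑ d ∈ Finset.range ⌊1 / h⌋₊,
          bondSum (fun k => iteratedDeriv k W) (leftChain u) (d + 1) ⌊1 / h⌋₊ h)
        + crossSum (fun k => iteratedDeriv k W) (rightChain u) (leftChain u) ⌊1 / h⌋₊ h) := by
  have hs : sites (-1) 1 0 h = Finset.Icc (-⌊1 / h⌋₊ : ℤ) ⌊1 / h⌋₊ := by
    rw [sites, k₁_eq hh, k₂_eq hh]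
  have hmem : ∀ i : ℤ, i ∈ Finset.Icc (-⌊1 / h⌋₊ : ℤ) ⌊1 / h⌋₊ →
      h * (0 + i) ∈ Icc (-1 : ℝ) 1 := fun i hi => (mem_sites hh i).1 (by rwa [hs])
  have hsum := sum_offDiag_Icc ⌊1 / h⌋₊
    (fun i j => W ((u (h * (0 + j)) - u (h * (0 + i))) / h)) fun i hi j hj hij => by
      have hlt : u (h * (0 + i)) < u (h * (0 + j)) := hu (hmem i hi) (hmem j hj) (by
        have : (i : ℝ) < j := by exact_mod_cast hij
        nlinarith)
      -- Evenness holds only away from `0`; strict monotonicity of `u` keeps the strain nonzero.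
      rw [hW_even _ (div_ne_zero (sub_ne_zero.2 hlt.ne) hh.ne')]
      congr 1
      ring
  rw [energy, hs, hsum, Int.card_Icc]
  generalize ⌊1 / h⌋₊ = n
  have hcard : (((n : ℤ) + 1 - -n).toNat : ℝ) = 2 * n + 1 := by
    exact_mod_cast (by omega : ((n : ℤ) + 1 - -n).toNat = 2 * n + 1)
  rw [hcard, mul_comm (2 : ℝ) (2 * n + 1), ← div_div, ← mul_assoc,
    div_mul_cancel₀ _ (two_ne_zero' ℝ)]
  congr 2
  · congr 1
    · refine Finset.sum_congr rfl fun d _ => ?_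
      rw [bondSum, Nat.add_sub_add_right]
      refine Finset.sum_congr rfl fun i _ => ?_
      simp only [rightChain, iteratedDeriv_zero, iteratedDerivWithin_zero]
      push_cast
      simp only [zero_add]
    · refine Finset.sum_congr rfl fun d _ => ?_
      rw [bondSum, Nat.add_sub_add_right]
      refine Finset.sum_congr rfl fun i _ => ?_
      simp only [leftChain, iteratedDeriv_zero, iteratedDerivWithin_zero]
      push_cast
      rw [show h * (0 + -((i : ℝ) + (d + 1))) = -(h * (i + (d + 1))) by ring,
        show h * (0 + -(i : ℝ)) = -(h * i) by ring]
      congr 1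
      ring
  · rw [crossSum]
    refine Finset.sum_congr rfl fun p _ => ?_
    simp only [crossArg, rightChain, leftChain, iteratedDeriv_zero, iteratedDerivWithin_zero]
    push_cast
    rw [show h * (0 + -((p.1 : ℝ) + 1)) = -(h * (p.1 + 1)) by ring, zero_add, neg_zero]
    congr 1
    ring

end Pairs

/-! ### Closed form of the second-order term for fixed `d`. -/

section Coefficients

variable {w v : ℕ → ℝ → ℝ} {m K M : ℝ} {β : ℕ → ℝ} {d : ℕ}

/-- The gradient term `W''(d v'(x)) v''(x)² d⁴` of the bonds between `d`-th neighbours. -/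
def gradTerm (w v : ℕ → ℝ → ℝ) (d : ℕ) (x : ℝ) : ℝ := w 2 (d * v 1 x) * v 2 x ^ 2 * d ^ 4

/-- The second-order contribution of an end of the chain is `endWeight` times `W'(d v') v''`. -/
def endWeight (a d : ℝ) : ℝ := 1 / 2 * ((1 / 6 - a + a ^ 2) * d + (a - 1 / 2) * d ^ 2
  + 1 / 3 * d ^ 3)

theorem continuousOn_gradTerm (P : DecayingPotential w m K β) (C : SmoothChain v m M)
    (hd : 1 ≤ d) : ContinuousOn (gradTerm w v d) (Icc 0 1) :=
  ((derivOn_comp P C hd 2).continuousOn.mul ((C.deriv 2).continuousOn.pow 2)).mul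
    continuousOn_const

theorem abs_gradTerm_le (P : DecayingPotential w m K β) (C : SmoothChain v m M) (hd : 1 ≤ d)
    {x : ℝ} (hx : x ∈ Icc (0 : ℝ) 1) : |gradTerm w v d x| ≤ K * M ^ 2 * (β d * d ^ 2) := by
  have b := P.bound 2 (by norm_num) d hd _ (C.arg_ge d hx)
  have c := C.bound 2 le_rfl (by norm_num) x hx
  have hK := P.Kβ_nonneg d
  have hM := C.one_le
  simp only [gradTerm, abs_mul, abs_pow, Nat.abs_cast]
  calc _ = (|w 2 (d * v 1 x)| * d ^ 2) * |v 2 x| ^ 2 * d ^ 2 := by ring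
    _ ≤ (K * β d) * M ^ 2 * d ^ 2 := by gcongr
    _ = _ := by ring

/-- Integration by parts: `correction` plus `gradTerm / 24` is the derivative of `d³/24 W'(d v') v''
- profile₁ / 24`. -/
theorem integral_correction (P : DecayingPotential w m K β) (C : SmoothChain v m M) (hd : 1 ≤ d) :
    ∫ x in (0 : ℝ)..1, correction w v d x =
      d ^ 3 / 24 * (w 1 (d * v 1 1) * v 2 1 - w 1 (d * v 1 0) * v 2 0)
      - (profile₁ w v d 1 - profile₁ w v d 0) / 24
      - 1 / 24 * ∫ x in (0 : ℝ)..1, gradTerm w v d x := by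
  have hF : DerivOn (fun x => d ^ 3 / 24 * (w 1 (d * v 1 x) * v 2 x) - profile₁ w v d x / 24)
      (fun x => correction w v d x + 1 / 24 * gradTerm w v d x) (Icc 0 1) := by
    intro x hx
    refine ((((derivOn_comp P C hd 1 x hx).mul (C.deriv 2 x hx)).const_mul ((d : ℝ) ^ 3 / 24)).sub
      ((derivOn_profile₁ P C hd x hx).div_const 24)).congr_deriv ?_
    simp only [correction, gradTerm]
    ring
  have hc := (derivOn_correction P C hd).continuousOn
  have hg := (continuousOn_gradTerm P C hd).const_mul (1 / 24)
  have hi : ∀ {f : ℝ → ℝ}, ContinuousOn f (Icc 0 1) → IntervalIntegrable f volume 0 1 :=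
    fun hf => (hf.mono (by rw [uIcc_of_le zero_le_one])).intervalIntegrable
  have := hF.integral_eq (hc.add hg)
  rw [intervalIntegral.integral_add (hi hc) (hi hg), intervalIntegral.integral_const_mul] at this
  linarith

/-- At `1` the coefficient of `W'(d v') v''` is `d³/24 - d/24 + (d/2) (a + (d-1)/2)²`, which is
`endWeight a d`. At `0`, where the chain starts exactly on an atom, the same formula holds with `a =
0`. -/
theorem bondLimit_eq (P : DecayingPotential w m K β) (C : SmoothChain v m M) (hd : 1 ≤ d)
    (a : ℝ) : bondLimit w v a d = -(1 / 24) * (∫ x in (0 : ℝ)..1, gradTerm w v d x)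
      + endWeight a d * (w 1 (d * v 1 1) * v 2 1) - endWeight 0 d * (w 1 (d * v 1 0) * v 2 0) := by
  rw [bondLimit, integral_correction P C hd, endWeight, endWeight, profile₁, profile₁]
  ring

theorem exists_abs_endWeight_le (a : ℝ) :
    ∃ c, 0 ≤ c ∧ ∀ d : ℕ, 1 ≤ d → |endWeight a d| ≤ c * d ^ 3 := by
  refine ⟨1 / 2 * (|1 / 6 - a + a ^ 2| + |a - 1 / 2| + 1 / 3), by positivity, fun d hd => ?_⟩
  have hd1 : (1 : ℝ) ≤ d := by exact_mod_cast hd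
  have h1 : (d : ℝ) ≤ d ^ 3 := le_self_pow₀ hd1 (by norm_num)
  have h2 : (d : ℝ) ^ 2 ≤ d ^ 3 := pow_le_pow_right₀ hd1 (by norm_num)
  rw [endWeight, abs_mul, abs_of_pos (by norm_num : (0 : ℝ) < 1 / 2), mul_assoc]
  refine mul_le_mul_of_nonneg_left ((abs_add_three _ _ _).trans ?_) (by norm_num)
  rw [abs_mul, abs_mul, abs_mul, abs_pow, abs_pow, Nat.abs_cast,
    abs_of_pos (by norm_num : (0 : ℝ) < 1 / 3)]
  calc _ ≤ |1 / 6 - a + a ^ 2| * (d : ℝ) ^ 3 + |a - 1 / 2| * d ^ 3 + 1 / 3 * d ^ 3 := by gcongr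
    _ = _ := by ring

theorem summable_weight_profile (P : DecayingPotential w m K β) (C : SmoothChain v m M)
    (hβ : Summable fun d : ℕ => β d * d ^ 2) {x : ℝ} (hx : x ∈ Icc (0 : ℝ) 1) {c : ℕ → ℝ}
    (hc : ∀ d, 1 ≤ d → |c d| ≤ d ^ 2) :
    Summable fun d : ℕ => c (d + 1) * profile w v (d + 1) x := by
  refine DecayingPotential.summable_of_le hβ (c := K) (g := fun d => c d * profile w v d x)
    fun d hd => ?_
  have := abs_profile_le P C hd hx
  rw [abs_mul]
  calc _ ≤ (d : ℝ) ^ 2 * (K * β d) := by gcongr; exact hc d hd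
    _ = _ := by ring

/-- The weight is cubic in `d`, and the decay of `w 1` recovers one power. -/
theorem summable_endWeight (P : DecayingPotential w m K β) (C : SmoothChain v m M)
    (hβ : Summable fun d : ℕ => β d * d ^ 2) {x : ℝ} (hx : x ∈ Icc (0 : ℝ) 1) (a : ℝ) :
    Summable fun d : ℕ =>
      endWeight a ((d + 1 : ℕ) : ℝ) * (w 1 ((d + 1 : ℕ) * v 1 x) * v 2 x) := by
  obtain ⟨c, hc0, hc⟩ := exists_abs_endWeight_le a
  refine DecayingPotential.summable_of_le hβ (c := c * (K * M))
    (g := fun d : ℕ => endWeight a d * (w 1 (d * v 1 x) * v 2 x)) fun d hd => ?_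
  have b := P.bound 1 (by norm_num) d hd _ (C.arg_ge d hx)
  have b2 := C.bound 2 le_rfl (by norm_num) x hx
  have hK := P.Kβ_nonneg d
  rw [abs_mul, abs_mul]
  calc _ ≤ c * d ^ 3 * (|w 1 (d * v 1 x)| * |v 2 x|) := by gcongr; exact hc d hd
    _ = c * d ^ 2 * ((|w 1 (d * v 1 x)| * d ^ 1) * |v 2 x|) := by ring
    _ ≤ c * d ^ 2 * ((K * β d) * M) := by gcongr
    _ = _ := by ring

theorem summable_integral_gradTerm (P : DecayingPotential w m K β) (C : SmoothChain v m M)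
    (hβ : Summable fun d : ℕ => β d * d ^ 2) :
    Summable fun d : ℕ => ∫ x in (0 : ℝ)..1, gradTerm w v (d + 1) x := by
  refine DecayingPotential.summable_of_le hβ (c := K * M ^ 2)
    (g := fun d => ∫ x in (0 : ℝ)..1, gradTerm w v d x) fun d hd => ?_
  have := intervalIntegral.norm_integral_le_of_norm_le_const (a := 0) (b := 1)
    (f := gradTerm w v d) (fun x hx => by
      rw [uIoc_of_le zero_le_one] at hx
      exact abs_gradTerm_le P C hd (Ioc_subset_Icc_self hx))
  rwa [sub_zero, abs_one, mul_one] at this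

end Coefficients

/-! ### Expansion of the energy of one chain. -/

section ChainSums

variable {w v : ℕ → ℝ → ℝ} {m K M : ℝ} {β : ℕ → ℝ}

/-- The bulk energy of a chain. -/
def chainBulk (w v : ℕ → ℝ → ℝ) : ℝ := ∑' d : ℕ, ∫ x in (0 : ℝ)..1, profile w v (d + 1) x

/-- The energy density of a chain at `x`. -/
def chainDensity (w v : ℕ → ℝ → ℝ) (x : ℝ) : ℝ := ∑' d : ℕ, profile w v (d + 1) x

/-- The energy of the bonds missing at an end `x` of a chain. -/
def chainMoment (w v : ℕ → ℝ → ℝ) (x : ℝ) : ℝ := ∑' d : ℕ, (d : ℝ) * profile w v (d + 1) x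

/-- The gradient energy of a chain. -/
def chainGrad (w v : ℕ → ℝ → ℝ) : ℝ := ∑' d : ℕ, ∫ x in (0 : ℝ)..1, gradTerm w v (d + 1) x

/-- The second-order contribution of an end `x` of a chain. -/
def chainSlope (w v : ℕ → ℝ → ℝ) (a x : ℝ) : ℝ :=
  ∑' d : ℕ, endWeight a ((d + 1 : ℕ) : ℝ) * (w 1 ((d + 1 : ℕ) * v 1 x) * v 2 x)

theorem hasSum_chainDensity (P : DecayingPotential w m K β) (C : SmoothChain v m M)
    (hβ : Summable fun d : ℕ => β d * d ^ 2) {x : ℝ} (hx : x ∈ Icc (0 : ℝ) 1) :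
    HasSum (fun d : ℕ => profile w v (d + 1) x) (chainDensity w v x) := by
  have := summable_weight_profile P C hβ hx (c := fun _ => 1) fun d hd => by
    rw [abs_one]; exact one_le_pow₀ (by exact_mod_cast hd)
  simp only [one_mul] at this
  exact this.hasSum

theorem hasSum_chainMoment (P : DecayingPotential w m K β) (C : SmoothChain v m M)
    (hβ : Summable fun d : ℕ => β d * d ^ 2) {x : ℝ} (hx : x ∈ Icc (0 : ℝ) 1) :
    HasSum (fun d : ℕ => (d : ℝ) * profile w v (d + 1) x) (chainMoment w v x) := by
  have := summable_weight_profile P C hβ hx (c := fun d => (d : ℝ) - 1) fun d hd => by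
    have hd1 : (1 : ℝ) ≤ d := by exact_mod_cast hd
    rw [abs_of_nonneg (by linarith)]
    nlinarith
  simp only [Nat.cast_add, Nat.cast_one, add_sub_cancel_right] at this
  exact this.hasSum

theorem tendsto_chainSum (P : DecayingPotential w m K β) (C : SmoothChain v m M)
    (hβ : Summable fun d : ℕ => β d * d ^ 2)
    {h : ℕ → ℝ} {n : ℕ → ℕ} {a : ℝ} (L : LatticeSeq h n a) :
    Tendsto (fun q => ((∑ d ∈ Finset.range (n q), bondSum w v (d + 1) (n q) (h q))
      - (1 / h q) * chainBulk w v + (chainMoment w v 0 + chainMoment w v 1) / 2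
      + (1 - h q * n q) / h q * chainDensity w v 1) / h q) atTop
      (𝓝 (-(1 / 24) * chainGrad w v + chainSlope w v a 1 - chainSlope w v 0 0)) := by
  have z0 : (0 : ℝ) ∈ Icc (0 : ℝ) 1 := by simp
  have z1 : (1 : ℝ) ∈ Icc (0 : ℝ) 1 := by simp
  have h1 : ∑' d : ℕ, (d : ℝ) / 2 * (profile w v (d + 1) 0 + profile w v (d + 1) 1)
      = (chainMoment w v 0 + chainMoment w v 1) / 2 := by
    rw [← (((hasSum_chainMoment P C hβ z0).add (hasSum_chainMoment P C hβ z1)).div_const 2).tsum_eq]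
    exact tsum_congr fun d => by ring
  have h2 : ∑' d : ℕ, bondLimit w v a (d + 1)
      = -(1 / 24) * chainGrad w v + chainSlope w v a 1 - chainSlope w v 0 0 := by
    refine HasSum.tsum_eq ?_
    refine ((((summable_integral_gradTerm P C hβ).hasSum.mul_left (-(1 / 24))).add
      (summable_endWeight P C hβ z1 a).hasSum).sub
      (summable_endWeight P C hβ z0 0).hasSum).congr_fun fun d => ?_
    rw [bondLimit_eq P C (by omega)]
  have := tendsto_chain P C hβ L
  rwa [h1, h2] at this

end ChainSums

/-! ### Offsets of the lattice and division by the number of atoms. -/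

section Sequence

/-- Since `k₁ = -n`, the left offset `ε k₁ + 1` is the gap `1 - ε n`; dividing its expansion by `ε`
gives `a₁ + a₂ ε + o(ε)`. -/
theorem latticeSeq_of_offset {ε : ℕ → ℝ} {a₁ a₂ b₁ b₂ c₁ c₂ : ℝ} (hpos : ∀ n, 0 < ε n)
    (hlim : Tendsto ε atTop (𝓝 0)) (hε : HasOffsetExpansion (-1) 1 0 ε a₁ a₂ b₁ b₂ c₁ c₂) :
    LatticeSeq ε (fun q => ⌊1 / ε q⌋₊) a₁ ∧
      Tendsto (fun q => ((1 - ε q * ⌊1 / ε q⌋₊) / ε q - a₁) / ε q) atTop (𝓝 a₂) := by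
  have hr : Tendsto (fun q => ((1 - ε q * ⌊1 / ε q⌋₊) / ε q - a₁) / ε q) atTop (𝓝 a₂) := by
    have := (hε.left.tendsto_div_nhds_zero).const_add a₂
    rw [add_zero] at this
    refine this.congr fun q => ?_
    have hq := (hpos q).ne'
    rw [k₁_eq (hpos q)]
    push_cast
    field_simp
    ring
  refine ⟨⟨hpos, .of_forall fun q => ?_, fun q => ?_, hlim, ?_⟩, hr⟩
  · have := Nat.floor_le (one_div_nonneg.2 (hpos q).le)
    rwa [le_div_iff₀ (hpos q), mul_comm] at this
  · have := Nat.lt_floor_add_one (1 / ε q)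
    rwa [div_lt_iff₀ (hpos q), mul_comm] at this
  · have := (hlim.mul hr).const_add a₁
    rw [zero_mul, add_zero] at this
    refine this.congr fun q => ?_
    have hq := (hpos q).ne'
    field_simp
    ring

/-- Division of the expansion of the total energy by the number `n` of atoms, where `σ h` is the
distance from the last atom to the end. -/
theorem tendsto_energy_remainder {h σ S n : ℕ → ℝ} {A P F C a₁ a₂ : ℝ} (hpos : ∀ q, 0 < h q)
    (hlim : Tendsto h atTop (𝓝 0)) (hσ : Tendsto σ atTop (𝓝 a₁))
    (hr : Tendsto (fun q => (σ q - a₁) / h q) atTop (𝓝 a₂))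
    (hS : Tendsto (fun q => (S q - 1 / h q * A + P + σ q * F) / h q) atTop (𝓝 C))
    (hn : ∀ q, n q * h q = 2 * (1 - h q * (σ q - 1 / 2))) :
    Tendsto (fun q => (1 / n q * S q - (A / 2
      + h q * ((a₁ - 1 / 2) * (A / 2) - (P + a₁ * F) / 2)
      + h q ^ 2 * ((a₂ + (a₁ - 1 / 2) ^ 2) * (A / 2)
        - ((a₁ - 1 / 2) * (P + a₁ * F) + a₂ * F) / 2 + C / 2))) / h q ^ 2) atTop (𝓝 0) := by
  have hκ : Tendsto (fun q => σ q - 1 / 2) atTop (𝓝 (a₁ - 1 / 2)) := hσ.sub_const _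
  have hD : Tendsto (fun q => 1 - h q * (σ q - 1 / 2)) atTop (𝓝 1) := by
    simpa using (hlim.mul hκ).const_sub 1
  have hQ : Tendsto (fun q => (1 - h q * (σ q - 1 / 2))⁻¹) atTop (𝓝 1) := by
    simpa using hD.inv₀ one_ne_zero
  -- With `κ = σ - 1/2` and `D = 1 - h κ`, the prefactor is `h / (2 D)`, and `1/D = 1 + h κ + h² κ²
  -- / D` exactly. The summands are what remains after removing the terms of order `0` and `1` and
  -- dividing by `h²`.
  have key := (((((hr.mul_const A).add (((hκ.pow 2).mul hQ).mul_const A)).sub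
    (hr.mul_const F)).sub ((hκ.mul hQ).mul ((hσ.mul_const F).const_add P))).add
    (hS.mul hQ)).div_const 2 |>.sub_const ((a₂ + (a₁ - 1 / 2) ^ 2) * (A / 2)
        - ((a₁ - 1 / 2) * (P + a₁ * F) + a₂ * F) / 2 + C / 2)
  have hval : (a₂ * A + (a₁ - 1 / 2) ^ 2 * 1 * A - a₂ * F - (a₁ - 1 / 2) * 1 * (P + a₁ * F)
      + C * 1) / 2 - ((a₂ + (a₁ - 1 / 2) ^ 2) * (A / 2)
        - ((a₁ - 1 / 2) * (P + a₁ * F) + a₂ * F) / 2 + C / 2) = 0 := by ring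
  rw [hval] at key
  refine key.congr' ?_
  filter_upwards [hD.eventually_ne one_ne_zero] with q hq
  have hh := (hpos q).ne'
  have hn' : n q = 2 * (1 - h q * (σ q - 1 / 2)) / h q := by rw [eq_div_iff hh, hn q]
  rw [hn']
  generalize hDq : 1 - h q * (σ q - 1 / 2) = D at hq ⊢
  have hσq : σ q = (1 - D) / h q + 1 / 2 := by rw [← hDq]; field_simp; ring
  rw [hσq]
  field_simp
  ring

end Sequence

/-! ### Bulk and gradient integrals over both halves. -/

section Halves

theorem integral_series_halves {gr gl : ℕ → ℝ → ℝ} {b : ℕ → ℝ} {G : ℝ → ℝ}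
    (hgr : ∀ d, ContinuousOn (gr d) (Icc 0 1)) (hgl : ∀ d, ContinuousOn (gl d) (Icc 0 1))
    (hb : Summable b) (hgrb : ∀ d, ∀ x ∈ Icc (0 : ℝ) 1, |gr d x| ≤ b d)
    (hglb : ∀ d, ∀ x ∈ Icc (0 : ℝ) 1, |gl d x| ≤ b d)
    (hGr : ∀ x ∈ Ioo (0 : ℝ) 1, G x = ∑' d, gr d x)
    (hGl : ∀ x ∈ Ioo (0 : ℝ) 1, G (-x) = ∑' d, gl d x) :
    IntervalIntegrable G volume (-1) 1 ∧ ∫ x in (-1 : ℝ)..1, G x =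
      (∑' d, ∫ x in (0 : ℝ)..1, gr d x) + ∑' d, ∫ x in (0 : ℝ)..1, gl d x := by
  obtain ⟨i1, e1⟩ := integral_series hgr hb hgrb hGr
  obtain ⟨i2, e2⟩ := integral_series (G := fun x => G (-x)) hgl hb hglb hGl
  have i3 : IntervalIntegrable G volume (-1) 0 := by
    have := ((IntervalIntegrable.iff_comp_neg (by simp)).1 i2).symm
    simpa using this
  refine ⟨i3.trans i1, ?_⟩
  rw [← intervalIntegral.integral_add_adjacent_intervals i3 i1, e1, ← e2,
    intervalIntegral.integral_comp_neg (f := G)]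
  norm_num
  ring

variable {W u : ℝ → ℝ} {m K M : ℝ} {β : ℕ → ℝ}

theorem profile_rightChain (W u : ℝ → ℝ) (d : ℕ) (x : ℝ) :
    profile (fun k => iteratedDeriv k W) (rightChain u) d x = W (dR u x * d) := by
  rw [profile, rightChain, iteratedDerivWithin_one, mul_comm, iteratedDeriv_zero, dR]

theorem leftChain_one (u : ℝ → ℝ) (x : ℝ) : leftChain u 1 x = dL u (-x) := by
  rw [leftChain, iteratedDerivWithin_one, dL]
  norm_num

theorem leftChain_two (u : ℝ → ℝ) (x : ℝ) : leftChain u 2 x = -ddL u (-x) := by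
  rw [leftChain, ddL]
  norm_num

theorem rightChain_one (u : ℝ → ℝ) (x : ℝ) : rightChain u 1 x = dR u x := by
  rw [rightChain, iteratedDerivWithin_one, dR]

theorem rightChain_two (u : ℝ → ℝ) (x : ℝ) : rightChain u 2 x = ddR u x := rfl

theorem profile_leftChain (W u : ℝ → ℝ) (d : ℕ) (x : ℝ) :
    profile (fun k => iteratedDeriv k W) (leftChain u) d x = W (dL u (-x) * d) := by
  rw [profile, leftChain_one, mul_comm, iteratedDeriv_zero]

theorem bulk_term_right (W : ℝ → ℝ) (hr : IsSmoothDiffeoOn u (Icc 0 1)) {x : ℝ}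
    (hx : x ∈ Ioo (0 : ℝ) 1) (d : ℕ) :
    W (deriv u x * d) = profile (fun k => iteratedDeriv k W) (rightChain u) d x := by
  rw [← iteratedDeriv_one (f := u), iteratedDeriv_eq_rightChain hr 1 hx, profile, mul_comm,
    iteratedDeriv_zero]

theorem bulk_term_left (W : ℝ → ℝ) (hl : IsSmoothDiffeoOn u (Icc (-1) 0)) {x : ℝ}
    (hx : x ∈ Ioo (0 : ℝ) 1) (d : ℕ) :
    W (deriv u (-x) * d) = profile (fun k => iteratedDeriv k W) (leftChain u) d x := by
  rw [← iteratedDeriv_one (f := u), iteratedDeriv_neg_eq_leftChain hl 1 hx, profile, mul_comm,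
    iteratedDeriv_zero]
  norm_num

theorem gradient_term_right (W : ℝ → ℝ) (hr : IsSmoothDiffeoOn u (Icc 0 1)) {x : ℝ}
    (hx : x ∈ Ioo (0 : ℝ) 1) (d : ℕ) :
    iteratedDeriv 2 W (deriv u x * d) * iteratedDeriv 2 u x ^ 2 * d ^ 4
      = gradTerm (fun k => iteratedDeriv k W) (rightChain u) d x := by
  rw [← iteratedDeriv_one (f := u), iteratedDeriv_eq_rightChain hr 1 hx,
    iteratedDeriv_eq_rightChain hr 2 hx, gradTerm, mul_comm (d : ℝ)]

theorem gradient_term_left (W : ℝ → ℝ) (hl : IsSmoothDiffeoOn u (Icc (-1) 0)) {x : ℝ}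
    (hx : x ∈ Ioo (0 : ℝ) 1) (d : ℕ) :
    iteratedDeriv 2 W (deriv u (-x) * d) * iteratedDeriv 2 u (-x) ^ 2 * d ^ 4
      = gradTerm (fun k => iteratedDeriv k W) (leftChain u) d x := by
  rw [← iteratedDeriv_one (f := u), iteratedDeriv_neg_eq_leftChain hl 1 hx,
    iteratedDeriv_neg_eq_leftChain hl 2 hx, gradTerm, mul_comm (d : ℝ)]
  norm_num

theorem bulk_integral (P : DecayingPotential (fun k => iteratedDeriv k W) m K β)
    (Cr : SmoothChain (rightChain u) m M) (Cl : SmoothChain (leftChain u) m M)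
    (hβ : Summable fun d : ℕ => β d * d ^ 2)
    (hl : IsSmoothDiffeoOn u (Icc (-1) 0)) (hr : IsSmoothDiffeoOn u (Icc 0 1)) :
    IntervalIntegrable (bulkDensity W u) volume (-1) 1 ∧
      ∫ x in (-1 : ℝ)..1, bulkDensity W u x =
        chainBulk (fun k => iteratedDeriv k W) (rightChain u)
        + chainBulk (fun k => iteratedDeriv k W) (leftChain u) := by
  have hb : Summable fun d : ℕ => K * β (d + 1) :=
    DecayingPotential.summable_of_le hβ (c := K) (g := fun d => K * β d) fun d hd => by
      have : (1 : ℝ) ≤ d ^ 2 := one_le_pow₀ (by exact_mod_cast hd)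
      rw [abs_of_nonneg (P.Kβ_nonneg d), ← mul_assoc]
      exact le_mul_of_one_le_right (P.Kβ_nonneg d) this
  exact integral_series_halves
    (fun d => (derivOn_profile P Cr (by omega : 1 ≤ d + 1)).continuousOn)
    (fun d => (derivOn_profile P Cl (by omega : 1 ≤ d + 1)).continuousOn) hb
    (fun d x hx => abs_profile_le P Cr (by omega) hx)
    (fun d x hx => abs_profile_le P Cl (by omega) hx)
    (fun x hx => tsum_congr fun d => bulk_term_right W hr hx (d + 1))
    (fun x hx => tsum_congr fun d => bulk_term_left W hl hx (d + 1))

theorem gradient_integral (P : DecayingPotential (fun k => iteratedDeriv k W) m K β)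
    (Cr : SmoothChain (rightChain u) m M) (Cl : SmoothChain (leftChain u) m M)
    (hβ : Summable fun d : ℕ => β d * d ^ 2)
    (hl : IsSmoothDiffeoOn u (Icc (-1) 0)) (hr : IsSmoothDiffeoOn u (Icc 0 1)) :
    IntervalIntegrable (gradientDensity W u) volume (-1) 1 ∧
      ∫ x in (-1 : ℝ)..1, gradientDensity W u x =
        chainGrad (fun k => iteratedDeriv k W) (rightChain u)
        + chainGrad (fun k => iteratedDeriv k W) (leftChain u) :=
  integral_series_halves
    (fun d => continuousOn_gradTerm P Cr (by omega : 1 ≤ d + 1))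
    (fun d => continuousOn_gradTerm P Cl (by omega : 1 ≤ d + 1))
    (((summable_nat_add_iff 1).2 hβ).mul_left (K * M ^ 2))
    (fun d x hx => abs_gradTerm_le P Cr (by omega) hx)
    (fun d x hx => abs_gradTerm_le P Cl (by omega) hx)
    (fun x hx => tsum_congr fun d => gradient_term_right W hr hx (d + 1))
    (fun x hx => tsum_congr fun d => gradient_term_left W hl hx (d + 1))

theorem bulk_series (P : DecayingPotential (fun k => iteratedDeriv k W) m K β)
    (Cr : SmoothChain (rightChain u) m M) (Cl : SmoothChain (leftChain u) m M)
    (hβ : Summable fun d : ℕ => β d * d ^ 2)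
    (hl : IsSmoothDiffeoOn u (Icc (-1) 0)) (hr : IsSmoothDiffeoOn u (Icc 0 1)) {x : ℝ}
    (hx : x ∈ Ioo (-1 : ℝ) 0 ∪ Ioo (0 : ℝ) 1) :
    (SummableFrom 1 fun j => W (deriv u x * j)) ∧ SummableFrom 1 fun j =>
      iteratedDeriv 2 W (deriv u x * j) * iteratedDeriv 2 u x ^ 2 * j ^ 4 := by
  have hg := ((summable_nat_add_iff 1).2 hβ).mul_left (K * M ^ 2)
  rcases hx with hx | hx
  · have hx' : -x ∈ Ioo (0 : ℝ) 1 := ⟨neg_pos.2 hx.2, neg_lt.1 hx.1⟩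
    have hxI := Ioo_subset_Icc_self hx'
    rw [← neg_neg x]
    constructor
    · exact (hasSum_chainDensity P Cl hβ hxI).summable.congr fun d =>
        (bulk_term_left W hl hx' (d + 1)).symm
    · exact .of_norm_bounded hg fun d =>
        (congrArg _ (gradient_term_left W hl hx' (d + 1))).trans_le
          (abs_gradTerm_le P Cl (by omega) hxI)
  · have hxI := Ioo_subset_Icc_self hx
    constructor
    · exact (hasSum_chainDensity P Cr hβ hxI).summable.congr fun d =>
        (bulk_term_right W hr hx (d + 1)).symm
    · exact .of_norm_bounded hg fun d =>
        (congrArg _ (gradient_term_right W hr hx (d + 1))).trans_le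
          (abs_gradTerm_le P Cr (by omega) hxI)

end Halves

/-! ### Identification of the coefficients. -/

section Main

variable {W u : ℝ → ℝ} {m K M : ℝ} {β : ℕ → ℝ}

/-- In terms of `d = j - 1`, every weight of `W` in the single series of `E1` and `E2` is affine, so
two sums, `chainDensity` and `chainMoment`, express them all. -/
theorem hasSum_profile_pair (P : DecayingPotential (fun k => iteratedDeriv k W) m K β)
    (Cr : SmoothChain (rightChain u) m M) (Cl : SmoothChain (leftChain u) m M)
    (hβ : Summable fun d : ℕ => β d * d ^ 2) {x : ℝ} (hx : x ∈ Icc (0 : ℝ) 1) (b c : ℝ) :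
    HasSum (fun d : ℕ => (b + c * d) * (W (dL u (-x) * (d + 1 : ℕ)) + W (dR u x * (d + 1 : ℕ))))
      (b * (chainDensity (fun k => iteratedDeriv k W) (rightChain u) x
          + chainDensity (fun k => iteratedDeriv k W) (leftChain u) x)
        + c * (chainMoment (fun k => iteratedDeriv k W) (rightChain u) x
          + chainMoment (fun k => iteratedDeriv k W) (leftChain u) x)) := by
  refine ((((hasSum_chainDensity P Cr hβ hx).add (hasSum_chainDensity P Cl hβ hx)).mul_left b).add
    (((hasSum_chainMoment P Cr hβ hx).add (hasSum_chainMoment P Cl hβ hx)).mul_left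
      c)).congr_fun fun d => ?_
  rw [profile_rightChain, profile_leftChain]
  ring

theorem hasSum_slope_pair (P : DecayingPotential (fun k => iteratedDeriv k W) m K β)
    (Cr : SmoothChain (rightChain u) m M) (Cl : SmoothChain (leftChain u) m M)
    (hβ : Summable fun d : ℕ => β d * d ^ 2) {x : ℝ} (hx : x ∈ Icc (0 : ℝ) 1) (a : ℝ) :
    HasSum (fun d : ℕ => 2 * endWeight a ((d + 1 : ℕ) : ℝ)
        * (deriv W (dR u x * (d + 1 : ℕ)) * ddR u x
          - deriv W (dL u (-x) * (d + 1 : ℕ)) * ddL u (-x)))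
      (2 * (chainSlope (fun k => iteratedDeriv k W) (rightChain u) a x
        + chainSlope (fun k => iteratedDeriv k W) (leftChain u) a x)) := by
  refine (((summable_endWeight P Cr hβ hx a).hasSum.add
    (summable_endWeight P Cl hβ hx a).hasSum).mul_left 2).congr_fun fun d => ?_
  rw [rightChain_one, leftChain_one, rightChain_two, leftChain_two, iteratedDeriv_one,
    mul_comm ((d + 1 : ℕ) : ℝ), mul_comm ((d + 1 : ℕ) : ℝ)]
  ring

theorem crossArg₀_eq (u : ℝ → ℝ) (i j : ℕ) :
    crossArg₀ (rightChain u) (leftChain u) i j = dR u 0 * j + dL u 0 * i := by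
  rw [crossArg₀, rightChain_one, leftChain_one, neg_zero]

theorem crossLimit_eq (W u : ℝ → ℝ) (i j : ℕ) :
    2 * crossLimit (fun k => iteratedDeriv k W) (rightChain u) (leftChain u) i j
      = (ddR u 0 * j ^ 2 - ddL u 0 * i ^ 2) * deriv W (dR u 0 * j + dL u 0 * i) := by
  rw [crossLimit, crossArg₀_eq, rightChain_two, leftChain_two, neg_zero, iteratedDeriv_one]
  ring

/-- A series starting at `2` whose term at `1` vanishes. -/
theorem hasSum_from_two {f : ℝ → ℝ} {g : ℕ → ℝ} {s : ℝ} (hg : HasSum g s)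
    (hfg : ∀ d : ℕ, g d = f ((d + 1 : ℕ) : ℝ)) (h0 : g 0 = 0) :
    HasSum (fun d : ℕ => f ((d + 2 : ℕ) : ℝ)) s := by
  have := (hasSum_nat_add_iff' 1).2 hg
  rw [Finset.sum_range_one, h0, sub_zero] at this
  exact this.congr_fun fun d => (hfg (d + 1)).symm

/-- The total energy expands as `A/h - Q - σ F + h C + o(h)`; the conclusions match `E0`, `E1`, `E2`
with the result of dividing this by the number of atoms. -/
theorem coefficients (P : DecayingPotential (fun k => iteratedDeriv k W) m K β)
    (Cr : SmoothChain (rightChain u) m M) (Cl : SmoothChain (leftChain u) m M)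
    (hβ : Summable fun d : ℕ => β d * d ^ 2)
    (hβ' : Summable fun p : ℕ × ℕ => β (p.1 + 1 + (p.2 + 1)) * (p.1 + 1 + (p.2 + 1) : ℕ))
    (hl : IsSmoothDiffeoOn u (Icc (-1) 0)) (hr : IsSmoothDiffeoOn u (Icc 0 1)) (a₁ a₂ : ℝ)
    {w v z : ℕ → ℝ → ℝ} (hw : w = fun k => iteratedDeriv k W) (hv : v = rightChain u)
    (hz : z = leftChain u) {A Q F C : ℝ} (hA : A = chainBulk w v + chainBulk w z)
    (hQ : Q = (chainMoment w v 0 + chainMoment w v 1) / 2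
      + (chainMoment w z 0 + chainMoment w z 1) / 2
      - ∑' p : ℕ × ℕ, w 0 (crossArg₀ v z (p.1 + 1) (p.2 + 1)))
    (hF : F = chainDensity w v 1 + chainDensity w z 1)
    (hC : C = (-(1 / 24) * chainGrad w v + chainSlope w v a₁ 1 - chainSlope w v 0 0)
      + (-(1 / 24) * chainGrad w z + chainSlope w z a₁ 1 - chainSlope w z 0 0)
      + ∑' p : ℕ × ℕ, crossLimit w v z (p.1 + 1) (p.2 + 1)) :
    CoefficientsConverge W u a₁ a₂ ∧ E0 W u = A / 2 ∧
      E1 W u a₁ = (a₁ - 1 / 2) * (A / 2) - (Q + a₁ * F) / 2 ∧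
      E2 W u a₁ a₂ = (a₂ + (a₁ - 1 / 2) ^ 2) * (A / 2)
        - ((a₁ - 1 / 2) * (Q + a₁ * F) + a₂ * F) / 2 + C / 2 := by
  have z0 : (0 : ℝ) ∈ Icc (0 : ℝ) 1 := by simp
  have z1 : (1 : ℝ) ∈ Icc (0 : ℝ) 1 := by simp
  obtain ⟨i0, e0⟩ := bulk_integral P Cr Cl hβ hl hr
  obtain ⟨ig, eg⟩ := gradient_integral P Cr Cl hβ hl hr
  have hb1 := hasSum_profile_pair P Cr Cl hβ z1 (2 * a₁) 1
  have hb2 := hasSum_profile_pair P Cr Cl hβ z1 (a₁ / 2 - a₂ - a₁ ^ 2) (1 / 4 - a₁ / 2)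
  have hi1 := hasSum_profile_pair P Cr Cl hβ z0 0 1
  have hb3 := hasSum_slope_pair P Cr Cl hβ z1 a₁
  have hi2 := hasSum_slope_pair P Cr Cl hβ z0 0
  have hd1 := (summable_crossArg₀ P Cr Cl hβ').hasSum
  have hd2 := (summable_crossLimit P Cr Cl hβ').hasSum.mul_left 2
  subst hw hv hz
  have S1 : HasSum (fun d : ℕ => (((d + 1 : ℕ) : ℝ) + 2 * a₁ - 1)
      * (W (dL u (-1) * (d + 1 : ℕ)) + W (dR u 1 * (d + 1 : ℕ)))) _ :=
    hb1.congr_fun fun d => by push_cast; ring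
  have S2 : HasSum (fun d : ℕ => (((d + 2 : ℕ) : ℝ) - 1)
      * (W (dL u 0 * (d + 2 : ℕ)) + W (dR u 0 * (d + 2 : ℕ)))) _ :=
    -- At the kink the weight `j - 1` vanishes at `j = 1`, so the series may start at `2`: no
    -- nearest-neighbour bond crosses the atom at `0`.
    hasSum_from_two (f := fun j => (j - 1) * (W (dL u 0 * j) + W (dR u 0 * j))) hi1
      (fun d => by rw [neg_zero]; push_cast; ring) (by simp)
  have S3 : HasSum (fun d : ℕ => (-(1 / 4) + a₁ - a₂ - a₁ ^ 2
      + (1 / 4 - a₁ / 2) * ((d + 1 : ℕ) : ℝ))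
      * (W (dL u (-1) * (d + 1 : ℕ)) + W (dR u 1 * (d + 1 : ℕ)))) _ :=
    hb2.congr_fun fun d => by push_cast; ring
  have S4 : HasSum (fun d : ℕ => ((1 / 6 - a₁ + a₁ ^ 2) * ((d + 1 : ℕ) : ℝ)
      + (a₁ - 1 / 2) * ((d + 1 : ℕ) : ℝ) ^ 2 + 1 / 3 * ((d + 1 : ℕ) : ℝ) ^ 3)
        * (deriv W (dR u 1 * (d + 1 : ℕ)) * ddR u 1
          - deriv W (dL u (-1) * (d + 1 : ℕ)) * ddL u (-1))) _ :=
    hb3.congr_fun fun d => by rw [endWeight]; ring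
  have S5 : HasSum (fun d : ℕ => (1 / 6 * ((d + 2 : ℕ) : ℝ) - 1 / 2 * ((d + 2 : ℕ) : ℝ) ^ 2
      + 1 / 3 * ((d + 2 : ℕ) : ℝ) ^ 3)
        * (deriv W (dL u 0 * (d + 2 : ℕ)) * ddL u 0
          - deriv W (dR u 0 * (d + 2 : ℕ)) * ddR u 0)) _ :=
    -- Likewise `endWeight 0 1 = 0`, since `1/6 - 1/2 + 1/3 = 0`.
    hasSum_from_two (f := fun j => (1 / 6 * j - 1 / 2 * j ^ 2 + 1 / 3 * j ^ 3)
        * (deriv W (dL u 0 * j) * ddL u 0 - deriv W (dR u 0 * j) * ddR u 0)) hi2.neg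
      (fun d => by rw [neg_zero, endWeight]; ring) (by rw [endWeight]; norm_num)
  have S6 : HasSum (fun p : ℕ × ℕ =>
      W (dR u 0 * (p.2 + 1 : ℕ) + dL u 0 * (p.1 + 1 : ℕ))) _ :=
    hd1.congr_fun fun p => by rw [crossArg₀_eq, iteratedDeriv_zero]
  have S7 : HasSum (fun p : ℕ × ℕ =>
      (ddR u 0 * ((p.2 + 1 : ℕ) : ℝ) ^ 2 - ddL u 0 * ((p.1 + 1 : ℕ) : ℝ) ^ 2)
        * deriv W (dR u 0 * (p.2 + 1 : ℕ) + dL u 0 * (p.1 + 1 : ℕ))) _ :=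
    hd2.congr_fun fun p => by rw [crossLimit_eq]
  have hE0 : E0 W u = A / 2 := by rw [E0, e0, hA]; ring
  refine ⟨⟨fun x hx => (bulk_series P Cr Cl hβ hl hr hx).1, i0,
    fun x hx => (bulk_series P Cr Cl hβ hl hr hx).2, ig, S1.summable, S2.summable, S6.summable,
    S3.summable, S4.summable, S5.summable, S7.summable⟩, hE0, ?_, ?_⟩
  · rw [E1, hE0, seriesFrom, S1.tsum_eq, seriesFrom, S2.tsum_eq, doubleSeries, S6.tsum_eq, hQ, hF]
    ring
  · rw [E2, hE0, eg, seriesFrom, S3.tsum_eq, seriesFrom, S4.tsum_eq, seriesFrom, S2.tsum_eq,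
      seriesFrom, S5.tsum_eq, doubleSeries, S6.tsum_eq, doubleSeries, S7.tsum_eq, hQ, hF, hC]
    ring

end Main

end AtomChain

end

theorem theorem4p1
    (W : ℝ → ℝ) (hW : ContDiffOn ℝ ∞ W {0}ᶜ) (hW_even : ∀ x : ℝ, x ≠ 0 → W x = W (-x))
    (α R : ℝ) (hα : 3 < α) (hR : 0 < R)
    (hW_decay : ∀ i : ℕ, ∃ C : ℝ, 0 < C ∧
      ∀ x : ℝ, x ∉ Ioo (-R) R → |iteratedDeriv i W x| ≤ C * |x| ^ (-α - i))
    (u : ℝ → ℝ) (hu_cont : ContinuousOn u (Icc (-1) 1)) (hu_mono : MonotoneOn u (Icc (-1) 1))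
    (hu_left : AtomChain.IsSmoothDiffeoOn u (Icc (-1) 0))
    (hu_right : AtomChain.IsSmoothDiffeoOn u (Icc 0 1))
    (a₁ a₂ b₁ b₂ c₁ c₂ : ℝ)
    (ε : ℕ → ℝ) (hε_pos : ∀ n, 0 < ε n) (hε_lim : Tendsto ε atTop (𝓝 0))
    (hε : AtomChain.HasOffsetExpansion (-1) 1 0 ε a₁ a₂ b₁ b₂ c₁ c₂) :
    AtomChain.CoefficientsConverge W u a₁ a₂ ∧
    (fun n => AtomChain.energy W u (-1) 1 0 (ε n)
      - (AtomChain.E0 W u + ε n * AtomChain.E1 W u a₁ + ε n ^ 2 * AtomChain.E2 W u a₁ a₂))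
      =o[atTop] fun n => ε n ^ 2 := by
  obtain ⟨m, M, hm, Cr, Cl⟩ := AtomChain.exists_smoothChain hu_mono hu_left hu_right
  obtain ⟨K, P⟩ := AtomChain.exists_decayingPotential hW hα hW_decay hm
  have hβ := AtomChain.summable_rpow_mul_sq hα
  have hβ' := AtomChain.summable_rpow_add hα
  obtain ⟨L, hr⟩ := AtomChain.latticeSeq_of_offset hε_pos hε_lim hε
  have hstrict := AtomChain.strictMonoOn_of_halves hu_mono hu_left hu_right
  -- Opaque names keep these long expressions as atoms in the algebra below.
  obtain ⟨w, hw⟩ : ∃ w, w = fun k => iteratedDeriv k W := ⟨_, rfl⟩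
  obtain ⟨v, hv⟩ : ∃ v, v = AtomChain.rightChain u := ⟨_, rfl⟩
  obtain ⟨z, hz⟩ : ∃ z, z = AtomChain.leftChain u := ⟨_, rfl⟩
  obtain ⟨A, hA⟩ : ∃ A, A = AtomChain.chainBulk w v + AtomChain.chainBulk w z := ⟨_, rfl⟩
  obtain ⟨Q, hQ⟩ : ∃ Q, Q = (AtomChain.chainMoment w v 0 + AtomChain.chainMoment w v 1) / 2
      + (AtomChain.chainMoment w z 0 + AtomChain.chainMoment w z 1) / 2
      - ∑' p : ℕ × ℕ, w 0 (AtomChain.crossArg₀ v z (p.1 + 1) (p.2 + 1)) := ⟨_, rfl⟩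
  obtain ⟨F, hF⟩ : ∃ F, F = AtomChain.chainDensity w v 1 + AtomChain.chainDensity w z 1 :=
    ⟨_, rfl⟩
  obtain ⟨hconv, h0, h1, h2⟩ := AtomChain.coefficients P Cr Cl hβ hβ' hu_left hu_right a₁ a₂
    hw hv hz hA hQ hF rfl
  rw [← hw] at P
  rw [← hv] at Cr
  rw [← hz] at Cl
  refine ⟨hconv, ?_⟩
  rw [h0, h1, h2]
  refine (isLittleO_iff_tendsto' (.of_forall fun q hq =>
    absurd hq (pow_ne_zero 2 (hε_pos q).ne'))).2 ?_
  -- Both chains have the same gap, so the three expansions add up to the one required of `S`.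
  have hS := ((AtomChain.tendsto_chainSum P Cr hβ L).add (AtomChain.tendsto_chainSum P Cl hβ L)).add
    (AtomChain.tendsto_cross P Cr Cl hβ' L)
  refine (AtomChain.tendsto_energy_remainder (n := fun q => 2 * (⌊1 / ε q⌋₊ : ℝ) + 1)
    (S := fun q => (∑ d ∈ Finset.range ⌊1 / ε q⌋₊,
        AtomChain.bondSum w v (d + 1) ⌊1 / ε q⌋₊ (ε q))
      + (∑ d ∈ Finset.range ⌊1 / ε q⌋₊, AtomChain.bondSum w z (d + 1) ⌊1 / ε q⌋₊ (ε q))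
      + AtomChain.crossSum w v z ⌊1 / ε q⌋₊ (ε q)) (A := A) (P := Q) (F := F)
    hε_pos hε_lim L.gap hr (hS.congr fun q => ?_) fun q => ?_).congr fun q => ?_
  · rw [hA, hQ, hF]
    ring
  · have := (hε_pos q).ne'
    field_simp
    ring
  · rw [AtomChain.energy_eq hW_even hstrict (hε_pos q), ← hw, ← hv, ← hz]
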